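/- Let $G \rightrightarrows M$ be a (Hausdorff, second countable, finite-dimensional) Lie groupoid with source $\alpha$, target $\beta$, units $1_x$, and product $gh$ defined for $\alpha(g)=\beta(h)$. Put $T^\alpha G=\ker T\alpha$. For $g\in G$ let $R_g:\alpha^{-1}(\beta(g))\to\alpha^{-1}(\alpha(g))$, $h\mapsto hg$, be the right translation, with differential $dR_g: T^\alpha_hG\to T^\alpha_{hg}G$. Let $AG=T^\alpha G|_{1_M}$ be the Lie algebroid of $G$: its anchor is $\rho=T\beta|_{AG}$; a section $X\in\Gamma(AG)$ defines the right-invariant vector field $\overrightarrow{X}(g)=dR_g(X_{\beta(g)})$ on $G$; and $[X,Y]$ is the restriction of $[\overrightarrow X,\overrightarrow Y]$ to the units. A bivector $\Lambda\in\Gamma(\wedge^2AG)$ defines likewise the bivector field $\overrightarrow{\Lambda}(g)=(\wedge^2dR_g)(\Lambda_{\beta(g)})$ on $G$. For a Lie algebroid $A$ with anchor $\rho$ (in particular $A=TG$ or $A=AG$), a bivector $P\in\Gamma(\wedge^2A)$ and a bundle endomorphism $n:A\to A$, let $[P,P]$ be the Schouten bracket, let $P^\sharp:A^*\to A$, $P^\sharp\theta=P(\theta,\cdot)$,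 and for $X,Y\in\Gamma(A)$ and $\theta,\eta\in\Gamma(A^*)$ put $$\tau n(X,Y)=[nX,nY]-n[nX,Y]-n[X,nY]+n^2[X,Y],$$ $$[\theta,\eta]_{P}=\mathcal L_{P^\sharp\theta}\eta-\mathcal L_{P^\sharp\eta}\theta-d\big(\eta(P^\sharp\theta)\big),$$ $$C(P,n)(\theta,\eta)=[\theta,\eta]_{nP}-\big([n^*\theta,\eta]_P+[\theta,n^*\eta]_P-n^*[\theta,\eta]_P\big),$$ where $[\theta,\eta]_{nP}$ is given by the formula for $[\theta,\eta]_P$ with $n\circ P^\sharp$ in place of $P^\sharp$. Here $(\mathcal L_X\eta)(Z)=\rho(X)(\eta(Z))-\eta([X,Z])$ and $(df)(Z)=\rho(Z)(f)$. A Poisson–Nijenhuis structure on the manifold $G$ is a pair $(\Pi,N)$ of a smooth bivector field $\Pi$ and a smooth $(1,1)$-tensor $N$ on $G$ such that $[\Pi,\Pi]=0$, $\tau N=0$, $N\circ\Pi^\sharp=\Pi^\sharp\circ N^*$ and $C(\Pi,N)=0$. It is called right-invariant if $\Pi=\overrightarrow{\Lambda}$ for some $\Lambda\in\Gamma(\wedge^2AG)$,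 and if there is a smooth bundle endomorphism $n$ of $AG$ with $N=dR_g\circ n\circ dR_{g^{-1}}$ on $T^\alpha_gG$ for all $g\in G$. **Proposition.** Let $(\Pi,N)$ be a right-invariant Poisson–Nijenhuis structure on a Lie groupoid $G\rightrightarrows M$, with $\Pi=\overrightarrow{\Lambda}$, $\Lambda\in\Gamma(\wedge^2AG)$, and let $n=N|_{AG}$ be the restriction of $N$ to $AG$. Then 1. $[\Lambda,\Lambda]=0$ for the Schouten bracket of the Lie algebroid $AG$; 2. $\tau n(X,Y)=0$ for all $X,Y\in\Gamma(AG)$; 3. $n\circ\Lambda^\sharp=\Lambda^\sharp\circ n^*$; 4. $C(\Lambda,n)(\theta,\eta)=0$ for all $\theta,\eta\in\Gamma(A^*G)$. -/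

import Mathlib

open scoped Manifold ContDiff Topology

noncomputable section

/-! ### Contraction of bivectors -/

section Sharp

variable {V : Type*} [AddCommGroup V] [Module ℝ V]

/-- The alternating map sending `(X, Y)` to the contraction `α ↦ α(X) Y - α(Y) X` of `X ∧ Y`. -/
def contractTwo (V : Type*) [AddCommGroup V] [Module ℝ V] :
    V [⋀^Fin 2]→ₗ[ℝ] (Module.Dual ℝ V →ₗ[ℝ] V) where
  toFun v :=
    { toFun := fun α => α (v 0) • v 1 - α (v 1) • v 0
      map_add' := by
        intro α β
        simp only [LinearMap.add_apply, add_smul]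
        abel
      map_smul' := by
        intro c α
        simp only [LinearMap.smul_apply, smul_eq_mul, mul_smul, smul_sub, RingHom.id_apply] }
  map_update_add' := by
    intro inst v i x y
    obtain rfl : inst = instDecidableEqFin 2 := Subsingleton.elim _ _
    ext α
    fin_cases i <;> simp [add_smul] <;> abel
  map_update_smul' := by
    intro inst v i c x
    obtain rfl : inst = instDecidableEqFin 2 := Subsingleton.elim _ _
    ext α
    fin_cases i <;> simp [mul_smul, smul_sub, smul_comm c]
  map_eq_zero_of_eq' := by
    intro v i j hv hij
    have h : v 0 = v 1 := by
      fin_cases i <;> fin_cases j <;> simp_all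
    ext α
    simp [h]

/-- The map `P♯ : V* → V`, `α ↦ P(α, ·)`, of a bivector `P ∈ ⋀² V`, where
`(X ∧ Y)(α, β) = α(X) β(Y) - α(Y) β(X)`. -/
def sharp (P : ⋀[ℝ]^2 V) : Module.Dual ℝ V →ₗ[ℝ] V :=
  exteriorPower.alternatingMapLinearEquiv (contractTwo V) P

/-- The bivector `X ∧ Y`. -/
def wedgeTwo (X Y : V) : ⋀[ℝ]^2 V := exteriorPower.ιMulti ℝ 2 ![X, Y]

/-- The trivector `X ∧ Y ∧ Z`. -/
def wedgeThree (X Y Z : V) : ⋀[ℝ]^3 V := exteriorPower.ιMulti ℝ 3 ![X, Y, Z]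

end Sharp

/-! ### Calculus of bivectors, endomorphisms and forms of an algebroid -/

/-- The data entering the calculus of a Lie algebroid with fibers `V b` over a manifold `B`: the
anchor, the notion of a smooth section, and the bracket of sections. It is only used for the two
Lie algebroids constructed below: the tangent bundle of a manifold and the Lie algebroid of a Lie
groupoid. -/
structure AlgebroidData (E : Type*) [NormedAddCommGroup E] [NormedSpace ℝ E]
    {B : Type*} [TopologicalSpace B] [ChartedSpace E B]
    (V : B → Type*) [∀ b, AddCommGroup (V b)] [∀ b, Module ℝ (V b)] where
  /-- the anchor `ρ : A → TB` -/
  anchor : ∀ b, V b →ₗ[ℝ] TangentSpace 𝓘(ℝ, E) b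
  /-- the smooth sections, that is, the elements of `Γ(A)` -/
  IsSection : (∀ b, V b) → Prop
  /-- the bracket of two sections -/
  bracket : (∀ b, V b) → (∀ b, V b) → ∀ b, V b

namespace AlgebroidData

variable {E : Type*} [NormedAddCommGroup E] [NormedSpace ℝ E]
  {B : Type*} [TopologicalSpace B] [ChartedSpace E B]
  {V : B → Type*} [∀ b, AddCommGroup (V b)] [∀ b, Module ℝ (V b)]
  (A : AlgebroidData E V)

/-- Smooth 1-forms, the elements of `Γ(A*)`: their values on smooth sections are smooth. -/
def IsForm (α : ∀ b, Module.Dual ℝ (V b)) : Prop :=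
  ∀ X, A.IsSection X → ContMDiff 𝓘(ℝ, E) 𝓘(ℝ, ℝ) ∞ fun b => α b (X b)

/-- Smooth bivectors, the elements of `Γ(⋀² A)`: locally finite sums of wedge products of two
smooth sections. -/
def IsBivector (P : ∀ b, ⋀[ℝ]^2 (V b)) : Prop :=
  ∀ b, ∃ (p : ℕ) (X Y : Fin p → ∀ b, V b),
    (∀ i, A.IsSection (X i)) ∧ (∀ i, A.IsSection (Y i)) ∧
      ∀ᶠ c in 𝓝 b, P c = ∑ i, wedgeTwo (X i c) (Y i c)

/-- Smooth vector bundle endomorphisms of `A` over the identity. -/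
def IsEndomorphism (n : ∀ b, V b →ₗ[ℝ] V b) : Prop :=
  ∀ X, A.IsSection X → A.IsSection fun b => n b (X b)

/-- `S` is the Schouten bracket `[P, Q]` of the bivectors `P` and `Q`: if `P` is the sum of the
`X i ∧ Y i` and `Q` is the sum of the `Z j ∧ W j` near `b`, then at `b`, `S` is the sum of
`[X i ∧ Y i, Z j ∧ W j]`, where the Schouten bracket of decomposable bivectors is
`[X₁ ∧ X₂, Y₁ ∧ Y₂] = ∑ (-1)^(i+j) [X_i, Y_j] ∧ X_(3-i) ∧ Y_(3-j)`. -/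
def IsSchoutenBracket (P Q : ∀ b, ⋀[ℝ]^2 (V b)) (S : ∀ b, ⋀[ℝ]^3 (V b)) : Prop :=
  ∀ (b : B) (p q : ℕ) (X Y : Fin p → ∀ b, V b) (Z W : Fin q → ∀ b, V b),
    (∀ i, A.IsSection (X i)) → (∀ i, A.IsSection (Y i)) →
    (∀ j, A.IsSection (Z j)) → (∀ j, A.IsSection (W j)) →
    (∀ᶠ c in 𝓝 b, P c = ∑ i, wedgeTwo (X i c) (Y i c)) →
    (∀ᶠ c in 𝓝 b, Q c = ∑ j, wedgeTwo (Z j c) (W j c)) →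
    S b = ∑ i, ∑ j,
      (wedgeThree (A.bracket (X i) (Z j) b) (Y i b) (W j b)
        - wedgeThree (A.bracket (X i) (W j) b) (Y i b) (Z j b)
        - wedgeThree (A.bracket (Y i) (Z j) b) (X i b) (W j b)
        + wedgeThree (A.bracket (Y i) (W j) b) (X i b) (Z j b))

/-- The Nijenhuis torsion `[nX, nY] - n[nX, Y] - n[X, nY] + n²[X, Y]`. -/
def torsion (n : ∀ b, V b →ₗ[ℝ] V b) (X Y : ∀ b, V b) (b : B) : V b :=
  A.bracket (fun c => n c (X c)) (fun c => n c (Y c)) b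
    - n b (A.bracket (fun c => n c (X c)) Y b)
    - n b (A.bracket X (fun c => n c (Y c)) b)
    + n b (n b (A.bracket X Y b))

/-- The derivative `ρ(X)(f)` of a function along a section. -/
def act (X : ∀ b, V b) (f : B → ℝ) (b : B) : ℝ :=
  mfderiv 𝓘(ℝ, E) 𝓘(ℝ, ℝ) f b (A.anchor b (X b))

/-- The value on the section `Z` of the Lie derivative `L_X α` of a 1-form:
`(L_X α)(Z) = ρ(X)(α(Z)) - α([X, Z])`. -/
def lieDerivForm (X : ∀ b, V b) (α : ∀ b, Module.Dual ℝ (V b)) (Z : ∀ b, V b) (b : B) : ℝ :=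
  A.act X (fun c => α c (Z c)) b - α b (A.bracket X Z b)

/-- For a bivector with associated map `S = P♯`, so that `P(α, β) = β(S α)`, the value on the
section `Z` of the 1-form `[α, β]_P = L_{P♯α} β - L_{P♯β} α - d(P(α, β))`. -/
def formBracket (S : ∀ b, Module.Dual ℝ (V b) →ₗ[ℝ] V b) (α β : ∀ b, Module.Dual ℝ (V b))
    (Z : ∀ b, V b) (b : B) : ℝ :=
  A.lieDerivForm (fun c => S c (α c)) β Z b
    - A.lieDerivForm (fun c => S c (β c)) α Z b
    - A.act Z (fun c => β c (S c (α c))) b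

/-- The value on the section `Z` of the Magri-Morosi concomitant
`C(P, n)(α, β) = [α, β]_{nP} - ([n*α, β]_P + [α, n*β]_P - n*[α, β]_P)`,
where `nP` is the bivector with `(nP)♯ = n ∘ P♯`. -/
def concomitant (P : ∀ b, ⋀[ℝ]^2 (V b)) (n : ∀ b, V b →ₗ[ℝ] V b)
    (α β : ∀ b, Module.Dual ℝ (V b)) (Z : ∀ b, V b) (b : B) : ℝ :=
  A.formBracket (fun c => n c ∘ₗ sharp (P c)) α β Z b
    - (A.formBracket (fun c => sharp (P c)) (fun c => (n c).dualMap (α c)) β Z b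
      + A.formBracket (fun c => sharp (P c)) α (fun c => (n c).dualMap (β c)) Z b
      - A.formBracket (fun c => sharp (P c)) α β (fun c => n c (Z c)) b)

/-- `(P, n)` is a Poisson-Nijenhuis structure: `P` is a smooth bivector with `[P, P] = 0`, `n` is a
smooth endomorphism with vanishing Nijenhuis torsion, `n ∘ P♯ = P♯ ∘ n*`, and `C(P, n) = 0`. -/
structure IsPoissonNijenhuis (P : ∀ b, ⋀[ℝ]^2 (V b)) (n : ∀ b, V b →ₗ[ℝ] V b) : Prop where
  isBivector : A.IsBivector P
  isEndomorphism : A.IsEndomorphism n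
  poisson : A.IsSchoutenBracket P P 0
  nijenhuis : ∀ X Y, A.IsSection X → A.IsSection Y → ∀ b, A.torsion n X Y b = 0
  comm : ∀ b, n b ∘ₗ sharp (P b) = sharp (P b) ∘ₗ (n b).dualMap
  concomitant_eq_zero : ∀ α β Z, A.IsForm α → A.IsForm β → A.IsSection Z →
    ∀ b, A.concomitant P n α β Z b = 0

end AlgebroidData

/-- The tangent bundle `TB`, with the identity as anchor and the Lie bracket of vector fields. -/
def tangentAlgebroid (E : Type*) [NormedAddCommGroup E] [NormedSpace ℝ E]
    (B : Type*) [TopologicalSpace B] [ChartedSpace E B] [IsManifold 𝓘(ℝ, E) ∞ B] :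
    AlgebroidData E (fun b : B => TangentSpace 𝓘(ℝ, E) b) where
  anchor _ := LinearMap.id
  IsSection X := ContMDiff 𝓘(ℝ, E) 𝓘(ℝ, E).tangent ∞
    fun b => (⟨b, X b⟩ : TangentBundle 𝓘(ℝ, E) B)
  bracket X Y b := VectorField.mlieBracket 𝓘(ℝ, E) X Y b

/-! ### Lie groupoids -/

/-- A Lie groupoid `G ⇉ M` with source `src` and target `tgt`; the product `mul g h` is meaningful
for `src g = tgt h` only, and its values at other pairs play no role. Smoothness of the
multiplication is smoothness on the subset of composable pairs of `G × G`, which is an embedded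
submanifold. -/
structure LieGroupoid (E F : Type*) [NormedAddCommGroup E] [NormedSpace ℝ E]
    [NormedAddCommGroup F] [NormedSpace ℝ F]
    (G M : Type*) [TopologicalSpace G] [ChartedSpace E G] [TopologicalSpace M]
    [ChartedSpace F M] where
  src : G → M
  tgt : G → M
  unit : M → G
  inv : G → G
  mul : G → G → G
  src_unit : ∀ x, src (unit x) = x
  tgt_unit : ∀ x, tgt (unit x) = x
  src_mul : ∀ g h, src g = tgt h → src (mul g h) = src h
  tgt_mul : ∀ g h, src g = tgt h → tgt (mul g h) = tgt g
  mul_assoc : ∀ g h k, src g = tgt h → src h = tgt k → mul (mul g h) k = mul g (mul h k)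
  unit_mul : ∀ g, mul (unit (tgt g)) g = g
  mul_unit : ∀ g, mul g (unit (src g)) = g
  src_inv : ∀ g, src (inv g) = tgt g
  tgt_inv : ∀ g, tgt (inv g) = src g
  inv_mul : ∀ g, mul (inv g) g = unit (src g)
  mul_inv : ∀ g, mul g (inv g) = unit (tgt g)
  isSubmersion_src : Manifold.IsSubmersion 𝓘(ℝ, E) 𝓘(ℝ, F) ∞ src
  isSubmersion_tgt : Manifold.IsSubmersion 𝓘(ℝ, E) 𝓘(ℝ, F) ∞ tgt
  contMDiff_unit : ContMDiff 𝓘(ℝ, F) 𝓘(ℝ, E) ∞ unit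
  contMDiff_inv : ContMDiff 𝓘(ℝ, E) 𝓘(ℝ, E) ∞ inv
  contMDiffOn_mul : ContMDiffOn (𝓘(ℝ, E).prod 𝓘(ℝ, E)) 𝓘(ℝ, E) ∞
    (fun p : G × G => mul p.1 p.2) {p | src p.1 = tgt p.2}

namespace LieGroupoid

variable {E F : Type*} [NormedAddCommGroup E] [NormedSpace ℝ E]
  [NormedAddCommGroup F] [NormedSpace ℝ F]
  {G M : Type*} [TopologicalSpace G] [ChartedSpace E G] [TopologicalSpace M] [ChartedSpace F M]
  (𝒢 : LieGroupoid E F G M)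

/-- The fiber `A_x G = T^α_{1_x} G = ker (dα : T_{1_x} G → T_x M)` of the Lie algebroid. -/
def algFiber (x : M) : Submodule ℝ (TangentSpace 𝓘(ℝ, E) (𝒢.unit x)) :=
  LinearMap.ker (mfderiv 𝓘(ℝ, E) 𝓘(ℝ, F) 𝒢.src (𝒢.unit x)).toLinearMap

/-- The differential `dR_g : T^α_{1_{β(g)}} G → T^α_g G` of the right translation
`R_g : α⁻¹(β(g)) → α⁻¹(α(g))`, `h ↦ hg`, at the unit `1_{β(g)}`. Since `R_g` is only defined on an
`α`-fiber, this is a derivative within that fiber, restricted to the vectors tangent to it.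
Here `1_{β(g)} g = g`. -/
def dRight (g : G) : 𝒢.algFiber (𝒢.tgt g) →ₗ[ℝ] TangentSpace 𝓘(ℝ, E) g :=
  LinearMap.comp
    (mfderivWithin 𝓘(ℝ, E) 𝓘(ℝ, E) (fun h => 𝒢.mul h g) (𝒢.src ⁻¹' {𝒢.tgt g})
      (𝒢.unit (𝒢.tgt g))).toLinearMap
    (𝒢.algFiber (𝒢.tgt g)).subtype

/-- The right-invariant vector field on `G` defined by a section of `AG`. -/
def rightVectorField (X : ∀ x, 𝒢.algFiber x) (g : G) : TangentSpace 𝓘(ℝ, E) g :=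
  𝒢.dRight g (X (𝒢.tgt g))

/-- The right-invariant bivector field on `G` defined by a section of `⋀² AG`. -/
def rightBivector (P : ∀ x, ⋀[ℝ]^2 (𝒢.algFiber x)) (g : G) :
    ⋀[ℝ]^2 (TangentSpace 𝓘(ℝ, E) g) :=
  exteriorPower.map 2 (𝒢.dRight g) (P (𝒢.tgt g))

/-- The endomorphism `T(1 ∘ α)` of `T_{1_x} G`; here `1_{α(1_x)} = 1_x`. -/
def unitSrcDeriv (x : M) :
    TangentSpace 𝓘(ℝ, E) (𝒢.unit x) →ₗ[ℝ] TangentSpace 𝓘(ℝ, E) (𝒢.unit x) :=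
  (mfderiv 𝓘(ℝ, E) 𝓘(ℝ, E) (fun g => 𝒢.unit (𝒢.src g)) (𝒢.unit x)).toLinearMap

/-- The projection `v ↦ v - T(1 ∘ α)(v)` of `T_{1_x} G` onto `A_x G`. -/
def algProj [IsManifold 𝓘(ℝ, E) ∞ G] [IsManifold 𝓘(ℝ, F) ∞ M] (x : M)
    (v : TangentSpace 𝓘(ℝ, E) (𝒢.unit x)) : 𝒢.algFiber x :=
  ⟨v - 𝒢.unitSrcDeriv x v, by
    have hs : ContMDiff 𝓘(ℝ, E) 𝓘(ℝ, F) ∞ 𝒢.src := 𝒢.isSubmersion_src.contMDiff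
    have hu : ContMDiff 𝓘(ℝ, E) 𝓘(ℝ, E) ∞ fun g => 𝒢.unit (𝒢.src g) := 𝒢.contMDiff_unit.comp hs
    have h1 : HasMFDerivAt 𝓘(ℝ, E) 𝓘(ℝ, E) (fun g => 𝒢.unit (𝒢.src g)) (𝒢.unit x)
        (mfderiv 𝓘(ℝ, E) 𝓘(ℝ, E) (fun g => 𝒢.unit (𝒢.src g)) (𝒢.unit x)) :=
      (hu.mdifferentiableAt (by simp)).hasMFDerivAt
    have e : 𝒢.unit (𝒢.src (𝒢.unit x)) = 𝒢.unit x := by rw [𝒢.src_unit]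
    have h2 : HasMFDerivAt 𝓘(ℝ, E) 𝓘(ℝ, F) 𝒢.src (𝒢.unit (𝒢.src (𝒢.unit x)))
        (mfderiv 𝓘(ℝ, E) 𝓘(ℝ, F) 𝒢.src (𝒢.unit (𝒢.src (𝒢.unit x)))) :=
      (hs.mdifferentiableAt (by simp)).hasMFDerivAt
    have h3 := h2.comp (𝒢.unit x) h1
    have h4 : 𝒢.src ∘ (fun g => 𝒢.unit (𝒢.src g)) = 𝒢.src := by
      funext g
      exact 𝒢.src_unit _
    rw [h4] at h3
    have h5 := congrArg (fun T => T v) h3.mfderiv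
    rw [e] at h5
    refine (LinearMap.map_sub _ _ _).trans (sub_eq_zero.mpr ?_)
    exact h5⟩

/-- The Lie algebroid `AG`: its sections are the maps `x ↦ X(x) ∈ A_x G ⊆ T_{1_x} G` that are
smooth as maps `M → TG`, its anchor is `Tβ`, and the bracket of two sections is the restriction to
the units of the Lie bracket of the corresponding right-invariant vector fields. The latter bracket
is tangent to the `α`-fibers, so that `algProj` does not change its value; it only serves to
regard this value as an element of `A_x G`. -/
def algebroid [IsManifold 𝓘(ℝ, E) ∞ G] [IsManifold 𝓘(ℝ, F) ∞ M] :
    AlgebroidData F (fun x : M => 𝒢.algFiber x) where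
  anchor x := LinearMap.comp
    (mfderiv 𝓘(ℝ, E) 𝓘(ℝ, F) 𝒢.tgt (𝒢.unit x)).toLinearMap (𝒢.algFiber x).subtype
  IsSection X := ContMDiff 𝓘(ℝ, F) 𝓘(ℝ, E).tangent ∞
    fun x => (⟨𝒢.unit x, (X x : TangentSpace 𝓘(ℝ, E) (𝒢.unit x))⟩ : TangentBundle 𝓘(ℝ, E) G)
  bracket X Y x := 𝒢.algProj x
    (VectorField.mlieBracket 𝓘(ℝ, E) (𝒢.rightVectorField X) (𝒢.rightVectorField Y) (𝒢.unit x))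

/-- `(P, N)` is a right-invariant Poisson-Nijenhuis structure on `G`: a Poisson-Nijenhuis structure
such that `P` is the right-invariant bivector field of some `L ∈ Γ(⋀² AG)`, and such that for some
smooth endomorphism `n` of `AG` one has `N ∘ dR_g = dR_g ∘ n` on `A_{β(g)} G`, that is,
`N = dR_g ∘ n ∘ dR_{g⁻¹}` on `T^α_g G`, for all `g`. -/
structure IsRightInvariantPN [IsManifold 𝓘(ℝ, E) ∞ G] [IsManifold 𝓘(ℝ, F) ∞ M]
    (P : ∀ g : G, ⋀[ℝ]^2 (TangentSpace 𝓘(ℝ, E) g))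
    (N : ∀ g : G, TangentSpace 𝓘(ℝ, E) g →ₗ[ℝ] TangentSpace 𝓘(ℝ, E) g) : Prop where
  isPoissonNijenhuis : (tangentAlgebroid E G).IsPoissonNijenhuis P N
  bivector : ∃ L, 𝒢.algebroid.IsBivector L ∧ ∀ g, P g = 𝒢.rightBivector L g
  endomorphism : ∃ n, 𝒢.algebroid.IsEndomorphism n ∧
    ∀ g a, N g (𝒢.dRight g a) = 𝒢.dRight g (n (𝒢.tgt g) a)

end LieGroupoid

end

/-! All four identities for `AG` are the corresponding identities on `G`, applied to
right-translated data and read off at the units. At `1_x` right translation is the identity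
(`dRight_unit`), so a right-invariant field takes the value of its section there, and the bracket of
`AG` is by construction the bracket of right-invariant fields at the units. Since `N ∘ dR_g = dR_g ∘
n` and `Π♯` is `Λ♯` conjugated by `dR_g` and its dual, applying `N` or `Π♯` to right-invariant data
again gives right-invariant data, and each term on `G` becomes the matching term of `AG`.

Three points need work.

Smoothness: `dR_g` is a derivative within an `α`-fiber. A smooth family of parametrizations of the
fibers (`FiberParam`), given by the normal form of the submersion `α`, turns it into an ordinary
partial derivative of a smooth map; hence `contMDiffAt_rightVectorField`.

Tangency: right-invariant fields are killed by `Tα`, so their bracket is too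
(`mfderiv_mlieBracket_eq_zero`). Thus `algProj` changes nothing in the definition of the bracket,
which gives `coe_bracket`.

One-forms: a form on `AG` defines a right-invariant form only on `T^αG`, while `C(Π, N) = 0` is
tested on smooth forms on all of `G`. `exists_isForm_eq_dRight` supplies a smooth form on `G` with
the required restriction to `T^αG` near a given unit. This suffices: every operation is local, and
`formBracket_unit` shows that only this restriction matters. Functions are compared by `act_unit`:
the anchor is `Tβ`, so `ρ(X)(f)` at `x` is the derivative of `f ∘ β` along `X` at `1_x`. -/

/-! ### Smooth families of tangent vectors along a map -/

section TangentBundleMaps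

variable {EN HN N : Type*} [NormedAddCommGroup EN] [NormedSpace ℝ EN] [TopologicalSpace HN]
  {J : ModelWithCorners ℝ EN HN} [TopologicalSpace N] [ChartedSpace HN N]
  {E B : Type*} [NormedAddCommGroup E] [NormedSpace ℝ E] [TopologicalSpace B] [ChartedSpace E B]
  [IsManifold 𝓘(ℝ, E) ∞ B]
  {E' B' : Type*} [NormedAddCommGroup E'] [NormedSpace ℝ E'] [TopologicalSpace B']
  [ChartedSpace E' B'] [IsManifold 𝓘(ℝ, E') ∞ B']

/-- Applying the partial derivative of a smooth map depending on parameters to a smooth family of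
tangent vectors gives a smooth family of tangent vectors. -/
theorem ContMDiffAt.mfderiv_tangent_apply [IsManifold J ∞ N] {f : N → B → B'} {b : N → B}
    {v : ∀ x, TangentSpace 𝓘(ℝ, E) (b x)} {x₀ : N}
    (hf : ContMDiffAt (J.prod 𝓘(ℝ, E)) 𝓘(ℝ, E') ∞ (Function.uncurry f) (x₀, b x₀))
    (hv : ContMDiffAt J 𝓘(ℝ, E).tangent ∞ (fun x => (⟨b x, v x⟩ : TangentBundle 𝓘(ℝ, E) B)) x₀) :
    ContMDiffAt J 𝓘(ℝ, E').tangent ∞ (fun x => (⟨f x (b x),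
      mfderiv 𝓘(ℝ, E) 𝓘(ℝ, E') (f x) (b x) (v x)⟩ : TangentBundle 𝓘(ℝ, E') B')) x₀ := by
  have hb : ContMDiffAt J 𝓘(ℝ, E) ∞ b x₀ := (Bundle.contMDiffAt_totalSpace.1 hv).1
  have h1 := ContMDiffAt.mfderiv (m := ∞) f b hf hb (by simp)
  have h2 : ContMDiffAt J 𝓘(ℝ, E') ∞ (fun x => f x (b x)) x₀ :=
    hf.comp x₀ (contMDiffAt_id.prodMk hb)
  exact ContMDiffAt.clm_apply_of_inCoordinates h1 hv h2

theorem contMDiffAt_tangentBundle_model_iff {c w : N → E} {x₀ : N} :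
    ContMDiffAt J 𝓘(ℝ, E).tangent ∞ (fun x => (⟨c x, w x⟩ : TangentBundle 𝓘(ℝ, E) E)) x₀ ↔
      ContMDiffAt J 𝓘(ℝ, E) ∞ c x₀ ∧ ContMDiffAt J 𝓘(ℝ, E) ∞ w x₀ := by
  rw [Bundle.contMDiffAt_totalSpace]
  simp

/-- Smoothness is tested in a trivialization at `b x₀`, which is linear on the fibers over its base
set; continuity of `b` keeps nearby points over that set. The scalar and zero cases below use the
same argument. -/
theorem contMDiffAt_tangent_add {b : N → B} {v w : ∀ x, TangentSpace 𝓘(ℝ, E) (b x)} {x₀ : N}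
    (hv : ContMDiffAt J 𝓘(ℝ, E).tangent ∞ (fun x => (⟨b x, v x⟩ : TangentBundle 𝓘(ℝ, E) B)) x₀)
    (hw : ContMDiffAt J 𝓘(ℝ, E).tangent ∞ (fun x => (⟨b x, w x⟩ : TangentBundle 𝓘(ℝ, E) B)) x₀) :
    ContMDiffAt J 𝓘(ℝ, E).tangent ∞
      (fun x => (⟨b x, v x + w x⟩ : TangentBundle 𝓘(ℝ, E) B)) x₀ := by
  rw [Bundle.contMDiffAt_totalSpace] at hv hw ⊢
  refine ⟨hv.1, (hv.2.add hw.2).congr_of_eventuallyEq ?_⟩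
  set e := trivializationAt E (TangentSpace 𝓘(ℝ, E)) (b x₀)
  have : ∀ᶠ x in 𝓝 x₀, b x ∈ e.baseSet := hv.1.continuousAt
    (e.open_baseSet.mem_nhds (FiberBundle.mem_baseSet_trivializationAt' (b x₀)))
  filter_upwards [this] with x hx
  exact (e.linear ℝ hx).map_add _ _

theorem contMDiffAt_tangent_smul {b : N → B} {f : N → ℝ} {v : ∀ x, TangentSpace 𝓘(ℝ, E) (b x)}
    {x₀ : N} (hf : ContMDiffAt J 𝓘(ℝ, ℝ) ∞ f x₀)
    (hv : ContMDiffAt J 𝓘(ℝ, E).tangent ∞ (fun x => (⟨b x, v x⟩ : TangentBundle 𝓘(ℝ, E) B)) x₀) :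
    ContMDiffAt J 𝓘(ℝ, E).tangent ∞
      (fun x => (⟨b x, f x • v x⟩ : TangentBundle 𝓘(ℝ, E) B)) x₀ := by
  rw [Bundle.contMDiffAt_totalSpace] at hv ⊢
  refine ⟨hv.1, (hf.smul hv.2).congr_of_eventuallyEq ?_⟩
  set e := trivializationAt E (TangentSpace 𝓘(ℝ, E)) (b x₀)
  have : ∀ᶠ x in 𝓝 x₀, b x ∈ e.baseSet := hv.1.continuousAt
    (e.open_baseSet.mem_nhds (FiberBundle.mem_baseSet_trivializationAt' (b x₀)))
  filter_upwards [this] with x hx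
  exact (e.linear ℝ hx).map_smul _ _

theorem contMDiffAt_tangent_zero {b : N → B} {x₀ : N} (hb : ContMDiffAt J 𝓘(ℝ, E) ∞ b x₀) :
    ContMDiffAt J 𝓘(ℝ, E).tangent ∞
      (fun x => (⟨b x, (0 : TangentSpace 𝓘(ℝ, E) (b x))⟩ : TangentBundle 𝓘(ℝ, E) B)) x₀ := by
  rw [Bundle.contMDiffAt_totalSpace]
  refine ⟨hb, (contMDiffAt_const (c := (0 : E))).congr_of_eventuallyEq ?_⟩
  set e := trivializationAt E (TangentSpace 𝓘(ℝ, E)) (b x₀)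
  have : ∀ᶠ x in 𝓝 x₀, b x ∈ e.baseSet := hb.continuousAt
    (e.open_baseSet.mem_nhds (FiberBundle.mem_baseSet_trivializationAt' (b x₀)))
  filter_upwards [this] with x hx
  exact (e.linear ℝ hx).map_zero

theorem contMDiffAt_tangent_sum {ι : Type*} {b : N → B} (s : Finset ι)
    {v : ι → ∀ x, TangentSpace 𝓘(ℝ, E) (b x)} {x₀ : N} (hb : ContMDiffAt J 𝓘(ℝ, E) ∞ b x₀)
    (hv : ∀ i, ContMDiffAt J 𝓘(ℝ, E).tangent ∞
      (fun x => (⟨b x, v i x⟩ : TangentBundle 𝓘(ℝ, E) B)) x₀) :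
    ContMDiffAt J 𝓘(ℝ, E).tangent ∞
      (fun x => (⟨b x, ∑ i ∈ s, v i x⟩ : TangentBundle 𝓘(ℝ, E) B)) x₀ := by
  classical
  induction s using Finset.induction_on with
  | empty => simpa using contMDiffAt_tangent_zero hb
  | insert i s hi ih =>
    simp only [Finset.sum_insert hi]
    exact contMDiffAt_tangent_add (hv i) ih

end TangentBundleMaps

/-! ### Brackets of vector fields tangent to the fibers of a map -/

section LieBracket

variable {E B : Type*} [NormedAddCommGroup E] [NormedSpace ℝ E] [CompleteSpace E]
  [TopologicalSpace B] [ChartedSpace E B] [IsManifold 𝓘(ℝ, E) ∞ B]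
  {E' B' : Type*} [NormedAddCommGroup E'] [NormedSpace ℝ E'] [TopologicalSpace B']
  [ChartedSpace E' B'] [IsManifold 𝓘(ℝ, E') ∞ B']

/-- The Lie bracket of two vector fields tangent to the fibers of `q` is tangent to the fibers
of `q`, for a map `q` to a normed space. -/
theorem mfderiv_mlieBracket_eq_zero_of_model {q : B → E'} {V W : ∀ b : B, TangentSpace 𝓘(ℝ, E) b}
    {x : B} (hq : ContMDiffAt 𝓘(ℝ, E) 𝓘(ℝ, E') ∞ q x)
    (hV : ContMDiffAt 𝓘(ℝ, E) 𝓘(ℝ, E).tangent ∞ (fun b => (⟨b, V b⟩ : TangentBundle 𝓘(ℝ, E) B)) x)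
    (hW : ContMDiffAt 𝓘(ℝ, E) 𝓘(ℝ, E).tangent ∞ (fun b => (⟨b, W b⟩ : TangentBundle 𝓘(ℝ, E) B)) x)
    (hqV : ∀ᶠ b in 𝓝 x, mfderiv 𝓘(ℝ, E) 𝓘(ℝ, E') q b (V b) = 0)
    (hqW : ∀ᶠ b in 𝓝 x, mfderiv 𝓘(ℝ, E) 𝓘(ℝ, E') q b (W b) = 0) :
    mfderiv 𝓘(ℝ, E) 𝓘(ℝ, E') q x (VectorField.mlieBracket 𝓘(ℝ, E) V W x) = 0 := by
  set φ := extChartAt 𝓘(ℝ, E) x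
  set e₀ := φ x
  have hφe : φ.symm e₀ = x := by simp [φ, e₀]
  have htgt : φ.target ∈ 𝓝 e₀ := extChartAt_target_mem_nhds x
  have hf : ∀ᶠ e in 𝓝 e₀, ContMDiffAt 𝓘(ℝ, E) 𝓘(ℝ, E) ∞ φ.symm e := by
    filter_upwards [eventually_mem_nhds_iff.2 htgt] with e he
    exact (contMDiffOn_extChartAt_symm x).contMDiffAt he
  have hqn : ∀ᶠ b in 𝓝 x, MDifferentiableAt 𝓘(ℝ, E) 𝓘(ℝ, E') q b := by
    filter_upwards [(contMDiffAt_iff_contMDiffAt_nhds (n := 1) (by simp)).1 (hq.of_le (by simp))]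
      with b hb using hb.mdifferentiableAt (by simp)
  have htend : Filter.Tendsto φ.symm (𝓝 e₀) (𝓝 x) := by
    have := hf.self_of_nhds.continuousAt.tendsto
    rwa [hφe] at this
  have hinv : ∀ᶠ e in 𝓝 e₀, (mfderiv 𝓘(ℝ, E) 𝓘(ℝ, E) φ.symm e).IsInvertible := by
    filter_upwards [htgt] with e he
    have := isInvertible_mfderivWithin_extChartAt_symm (I := 𝓘(ℝ, E)) he
    rwa [modelWithCornersSelf_coe, Set.range_id, mfderivWithin_univ] at this
  -- The pullback applies the inverse of the derivative of `φ.symm`, which the chain rule for `q ∘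
  -- φ.symm` cancels.
  have key : ∀ (U : ∀ b : B, TangentSpace 𝓘(ℝ, E) b), ∀ᶠ e in 𝓝 e₀,
      fderiv ℝ (q ∘ φ.symm) e (VectorField.mpullback 𝓘(ℝ, E) 𝓘(ℝ, E) φ.symm U e)
        = mfderiv 𝓘(ℝ, E) 𝓘(ℝ, E') q (φ.symm e) (U (φ.symm e)) := by
    intro U
    filter_upwards [hf, hinv, htend.eventually hqn] with e h1 h2 h3
    have h4 := mfderiv_comp e h3 (h1.mdifferentiableAt (by simp))
    rw [← mfderiv_eq_fderiv, h4]
    exact congrArg (mfderiv 𝓘(ℝ, E) 𝓘(ℝ, E') q (φ.symm e)) (h2.self_apply_inverse _)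
  have hdiff : ∀ (U : ∀ b : B, TangentSpace 𝓘(ℝ, E) b),
      ContMDiffAt 𝓘(ℝ, E) 𝓘(ℝ, E).tangent ∞ (fun b => (⟨b, U b⟩ : TangentBundle 𝓘(ℝ, E) B)) x →
      DifferentiableAt ℝ (VectorField.mpullback 𝓘(ℝ, E) 𝓘(ℝ, E) φ.symm U) e₀ := by
    intro U hU
    have h1 := ContMDiffAt.mpullback_vectorField_preimage (m := ∞) (n := ∞) (f := φ.symm)
      (x₀ := e₀) (V := U) (by rw [hφe]; exact hU) hf.self_of_nhds hinv.self_of_nhds (by simp)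
    exact (contMDiffAt_tangentBundle_model_iff.1 h1).2.contDiffAt.differentiableAt (by simp)
  have hmd : ∀ (U : ∀ b : B, TangentSpace 𝓘(ℝ, E) b),
      ContMDiffAt 𝓘(ℝ, E) 𝓘(ℝ, E).tangent ∞ (fun b => (⟨b, U b⟩ : TangentBundle 𝓘(ℝ, E) B)) x →
      MDifferentiableAt 𝓘(ℝ, E) 𝓘(ℝ, E).tangent
        (fun b => (⟨b, U b⟩ : TangentBundle 𝓘(ℝ, E) B)) (φ.symm e₀) := by
    intro U hU
    rw [hφe]
    exact hU.mdifferentiableAt (by simp)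
  have hqφ : ContDiffAt ℝ ∞ (q ∘ φ.symm) e₀ := by
    refine ContMDiffAt.contDiffAt (ContMDiffAt.comp e₀ ?_ hf.self_of_nhds)
    rw [hφe]; exact hq
  have h2n : minSmoothness ℝ 2 ≤ (∞ : WithTop ℕ∞) := by
    rw [minSmoothness_of_isRCLikeNormedField]
    exact WithTop.coe_le_coe.2 (le_top : (2 : ℕ∞) ≤ ⊤)
  have : IsManifold 𝓘(ℝ, E) (minSmoothness ℝ 2) B := IsManifold.of_le h2n
  -- By symmetry of the second derivative, `Dq [V, W]` is the difference of the derivatives of `Dq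
  -- W` along `V` and of `Dq V` along `W`. Both functions vanish near `e₀`, hence so do their
  -- derivatives there.
  have h1 := VectorField.fderiv_apply_lieBracket hqφ h2n (hdiff W hW) (hdiff V hV)
  have h0 : ∀ (U : ∀ b : B, TangentSpace 𝓘(ℝ, E) b),
      (∀ᶠ b in 𝓝 x, mfderiv 𝓘(ℝ, E) 𝓘(ℝ, E') q b (U b) = 0) →
      (fun e => fderiv ℝ (q ∘ φ.symm) e (VectorField.mpullback 𝓘(ℝ, E) 𝓘(ℝ, E) φ.symm U e))
        =ᶠ[𝓝 e₀] fun _ => 0 := by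
    intro U hU
    filter_upwards [key U, htend.eventually hU] with e h2 h3
    exact h2.trans h3
  rw [(h0 W hqW).fderiv_eq, (h0 V hqV).fderiv_eq] at h1
  have h2 := VectorField.mpullback_mlieBracket (n := ∞) (hmd V hV) (hmd W hW) hf.self_of_nhds
    h2n
  rw [← VectorField.mlieBracketWithin_univ (V := VectorField.mpullback _ _ _ V),
    VectorField.mlieBracketWithin_eq_lieBracketWithin] at h2
  have h3 := (key (VectorField.mlieBracket 𝓘(ℝ, E) V W)).self_of_nhds
  rw [h2] at h3
  have h4 : mfderiv 𝓘(ℝ, E) 𝓘(ℝ, E') q (φ.symm e₀)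
      (VectorField.mlieBracket 𝓘(ℝ, E) V W (φ.symm e₀)) = 0 := by
    refine h3.symm.trans (Eq.trans ?_ (h1.trans (by rw [fderiv_fun_const]; exact sub_self _)))
    exact congrArg (fun u => fderiv ℝ (q ∘ φ.symm) e₀ (u e₀))
      (VectorField.lieBracketWithin_univ (𝕜 := ℝ))
  -- The base point `φ.symm e₀` equals `x` only propositionally; generalizing it to `y` allows the
  -- substitution in the dependent types.
  have h5 : ∀ y, y = x → mfderiv 𝓘(ℝ, E) 𝓘(ℝ, E') q y
      (VectorField.mlieBracket 𝓘(ℝ, E) V W y) = 0 → mfderiv 𝓘(ℝ, E) 𝓘(ℝ, E') q x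
      (VectorField.mlieBracket 𝓘(ℝ, E) V W x) = 0 := by rintro y rfl h; exact h
  exact h5 _ hφe h4

/-- A chart of the target reduces this to a map into a normed space, and its derivative is injective
at `q x`. -/
theorem mfderiv_mlieBracket_eq_zero {q : B → B'} {V W : ∀ b : B, TangentSpace 𝓘(ℝ, E) b}
    {x : B} (hq : ContMDiffAt 𝓘(ℝ, E) 𝓘(ℝ, E') ∞ q x)
    (hV : ContMDiffAt 𝓘(ℝ, E) 𝓘(ℝ, E).tangent ∞ (fun b => (⟨b, V b⟩ : TangentBundle 𝓘(ℝ, E) B)) x)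
    (hW : ContMDiffAt 𝓘(ℝ, E) 𝓘(ℝ, E).tangent ∞ (fun b => (⟨b, W b⟩ : TangentBundle 𝓘(ℝ, E) B)) x)
    (hqV : ∀ᶠ b in 𝓝 x, mfderiv 𝓘(ℝ, E) 𝓘(ℝ, E') q b (V b) = 0)
    (hqW : ∀ᶠ b in 𝓝 x, mfderiv 𝓘(ℝ, E) 𝓘(ℝ, E') q b (W b) = 0) :
    mfderiv 𝓘(ℝ, E) 𝓘(ℝ, E') q x (VectorField.mlieBracket 𝓘(ℝ, E) V W x) = 0 := by
  set ψ := extChartAt 𝓘(ℝ, E') (q x)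
  have hψ : ∀ᶠ b in 𝓝 x, MDifferentiableAt 𝓘(ℝ, E') 𝓘(ℝ, E') ψ (q b) := by
    filter_upwards [hq.continuousAt (extChartAt_source_mem_nhds (I := 𝓘(ℝ, E')) (q x))] with b hb
    exact mdifferentiableAt_extChartAt (by simpa using hb)
  have hqn : ∀ᶠ b in 𝓝 x, MDifferentiableAt 𝓘(ℝ, E) 𝓘(ℝ, E') q b := by
    filter_upwards [(contMDiffAt_iff_contMDiffAt_nhds (n := 1) (by simp)).1 (hq.of_le (by simp))]
      with b hb using hb.mdifferentiableAt (by simp)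
  have key : ∀ᶠ b in 𝓝 x, ∀ v, mfderiv 𝓘(ℝ, E) 𝓘(ℝ, E') (ψ ∘ q) b v
      = mfderiv 𝓘(ℝ, E') 𝓘(ℝ, E') ψ (q b) (mfderiv 𝓘(ℝ, E) 𝓘(ℝ, E') q b v) := by
    filter_upwards [hψ, hqn] with b h1 h2 v
    rw [mfderiv_comp b h1 h2, ContinuousLinearMap.comp_apply]
  have h1 := mfderiv_mlieBracket_eq_zero_of_model (q := ψ ∘ q) (V := V) (W := W) (x := x)
    ((contMDiffAt_extChartAt).comp x hq) hV hW
    (by filter_upwards [key, hqV] with b h1 h2; rw [h1, h2, map_zero])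
    (by filter_upwards [key, hqW] with b h1 h2; rw [h1, h2, map_zero])
  rw [key.self_of_nhds] at h1
  have h2 := (isInvertible_mfderiv_extChartAt (I := 𝓘(ℝ, E')) (mem_extChartAt_source (q x))).injective
  exact h2 (h1.trans (map_zero _).symm)

end LieBracket

/-! ### Parametrizing the fibers of a submersion along a section -/

section Submersion

variable {E F : Type*} [NormedAddCommGroup E] [NormedSpace ℝ E]
  [NormedAddCommGroup F] [NormedSpace ℝ F]
  {G M : Type*} [TopologicalSpace G] [ChartedSpace E G]
  [TopologicalSpace M] [ChartedSpace F M]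

/-- A smooth family `k y : K → G` of parametrizations of the fibers of `f : G → M` near the points
`u y` of a section `u`, with a map `p` whose restriction to the fibers has derivative inverse to
the one of the parametrization. -/
structure FiberParam (K : Type*) [NormedAddCommGroup K] [NormedSpace ℝ K] (f : G → M) (u : M → G)
    (x : M) where
  k : M → K → G
  p : G → K
  k_zero : ∀ᶠ y in 𝓝 x, k y 0 = u y
  f_k : ∀ᶠ z in 𝓝 (x, (0 : K)), f (k z.1 z.2) = z.1
  contMDiffAt_k : ∀ᶠ y in 𝓝 x,
    ContMDiffAt (𝓘(ℝ, F).prod 𝓘(ℝ, K)) 𝓘(ℝ, E) ∞ (Function.uncurry k) (y, 0)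
  contMDiffAt_p : ∀ᶠ g in 𝓝 (u x), ContMDiffAt 𝓘(ℝ, E) 𝓘(ℝ, K) ∞ p g
  deriv_k_p : ∀ᶠ y in 𝓝 x, ∀ v : E, mfderiv 𝓘(ℝ, E) 𝓘(ℝ, F) f (u y) v = (0 : F) →
    mfderiv 𝓘(ℝ, K) 𝓘(ℝ, E) (k y) (0 : K) (mfderiv 𝓘(ℝ, E) 𝓘(ℝ, K) p (u y) v : K) = v
  deriv_p_k : ∀ᶠ y in 𝓝 x, ∀ e : K,
    mfderiv 𝓘(ℝ, E) 𝓘(ℝ, K) p (u y) (mfderiv 𝓘(ℝ, K) 𝓘(ℝ, E) (k y) (0 : K) e : E) = e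

/-- In adapted charts `f` is the projection of `F × K` to `F`. The fiber over `y` is then a slice
parametrized by `K`, and the `K`-coordinate serves as `p`. -/
theorem Manifold.IsSubmersionAt.exists_fiberParam {f : G → M} {u : M → G} {x : M}
    (hf : Manifold.IsSubmersionAt 𝓘(ℝ, E) 𝓘(ℝ, F) ∞ f (u x))
    (hu : ContMDiff 𝓘(ℝ, F) 𝓘(ℝ, E) ∞ u) (hfu : ∀ y, f (u y) = y) :
    Nonempty (FiberParam (E := E) (F := F) hf.complement f u x) := by
  set K := hf.complement
  set φ := hf.domChart
  set ψ := hf.codChart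
  set T := hf.equiv
  have hφ : φ ∈ IsManifold.maximalAtlas 𝓘(ℝ, E) ∞ G := hf.domChart_mem_maximalAtlas
  have hψ : ψ ∈ IsManifold.maximalAtlas 𝓘(ℝ, F) ∞ M := hf.codChart_mem_maximalAtlas
  have hux : u x ∈ φ.source := hf.mem_domChart_source
  have hx : x ∈ ψ.source := by
    have := hf.mem_codChart_source
    rwa [hfu] at this
  have hsub : ∀ g ∈ φ.source, f g ∈ ψ.source := hf.source_subset_preimage_source
  have hw : ∀ g ∈ φ.source, ψ (f g) = (T (φ g)).1 := by
    intro g hg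
    have h1 : φ g ∈ (φ.extend 𝓘(ℝ, E)).target := by simpa using φ.map_source hg
    have h2 := hf.writtenInCharts h1
    have h3 : hf.domChart.symm (φ g) = g := φ.left_inv hg
    simp only [Function.comp_apply, OpenPartialHomeomorph.extend_coe,
      OpenPartialHomeomorph.extend_coe_symm, modelWithCornersSelf_coe,
      modelWithCornersSelf_coe_symm, id] at h2
    rwa [h3] at h2
  have hφs : ∀ e ∈ φ.target, ContMDiffAt 𝓘(ℝ, E) 𝓘(ℝ, E) ∞ φ.symm e := fun e he =>
    (contMDiffOn_symm_of_mem_maximalAtlas hφ).contMDiffAt (φ.open_target.mem_nhds he)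
  have hφd : ∀ g ∈ φ.source, ContMDiffAt 𝓘(ℝ, E) 𝓘(ℝ, E) ∞ φ g := fun g hg =>
    contMDiffAt_of_mem_maximalAtlas hφ hg
  have hψd : ∀ y ∈ ψ.source, ContMDiffAt 𝓘(ℝ, F) 𝓘(ℝ, F) ∞ ψ y := fun y hy =>
    contMDiffAt_of_mem_maximalAtlas hψ hy
  let p : G → K := fun g => (T (φ g)).2
  -- The first coordinate `ψ y` places the point over `y`; the shift by `p (u y)` makes `e = 0`
  -- correspond to `u y`.
  let c : M → K → E := fun y e => T.symm (ψ y, p (u y) + e)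
  let k : M → K → G := fun y e => φ.symm (c y e)
  have huy : ∀ᶠ y in 𝓝 x, u y ∈ φ.source :=
    hu.continuous.continuousAt (φ.open_source.mem_nhds hux)
  have hψy : ∀ᶠ y in 𝓝 x, y ∈ ψ.source := ψ.open_source.mem_nhds hx
  have hc0 : ∀ y, u y ∈ φ.source → c y 0 = φ (u y) := by
    intro y hy
    have h1 := hw _ hy
    rw [hfu] at h1
    simp only [c, p, add_zero, h1, Prod.mk.eta, ContinuousLinearEquiv.symm_apply_apply]
  have hp : ∀ g ∈ φ.source, ContMDiffAt 𝓘(ℝ, E) 𝓘(ℝ, K) ∞ p g := by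
    intro g hg
    have h1 : ContMDiffAt 𝓘(ℝ, E) 𝓘(ℝ, K) ∞ (fun e => (T e).2) (φ g) := by
      apply ContDiffAt.contMDiffAt
      fun_prop
    exact h1.comp g (hφd g hg)
  have hc : ∀ y, y ∈ ψ.source → u y ∈ φ.source → ∀ e : K,
      ContMDiffAt (𝓘(ℝ, F).prod 𝓘(ℝ, K)) 𝓘(ℝ, E) ∞ (Function.uncurry c) (y, e) := by
    intro y hy huy e
    have h1 : ContMDiffAt (𝓘(ℝ, F).prod 𝓘(ℝ, K)) 𝓘(ℝ, F) ∞ (fun z : M × K => ψ z.1) (y, e) :=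
      (hψd y hy).comp (y, e) contMDiffAt_fst
    have h2 : ContMDiffAt (𝓘(ℝ, F).prod 𝓘(ℝ, K)) 𝓘(ℝ, K) ∞ (fun z : M × K => p (u z.1) + z.2)
        (y, e) :=
      (((hp _ huy).comp y hu.contMDiffAt).comp (y, e) contMDiffAt_fst).add contMDiffAt_snd
    have h3 := (T.symm.contDiff (n := ∞)).contMDiff.contMDiffAt.comp (y, e) (h1.prodMk_space h2)
    exact h3
  have hA : ∀ g ∈ φ.source, ∃ A B : E →L[ℝ] E,
      HasMFDerivAt 𝓘(ℝ, E) 𝓘(ℝ, E) φ g A ∧ HasMFDerivAt 𝓘(ℝ, E) 𝓘(ℝ, E) φ.symm (φ g) B ∧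
        (∀ v, A (B v) = v) ∧ ∀ v, B (A v) = v := by
    intro g hg
    have h1 := ((hφd g hg).mdifferentiableAt (by simp)).hasMFDerivAt
    have h2 := ((hφs _ (φ.map_source hg)).mdifferentiableAt (by simp)).hasMFDerivAt
    refine ⟨_, _, h1, h2, fun v => ?_, fun v => ?_⟩
    · have h3 : HasMFDerivAt 𝓘(ℝ, E) 𝓘(ℝ, E) φ (φ.symm (φ g))
          (mfderiv 𝓘(ℝ, E) 𝓘(ℝ, E) φ g : E →L[ℝ] E) := by rw [φ.left_inv hg]; exact h1
      have h4 := h3.comp (φ g) h2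
      have h5 : φ ∘ φ.symm =ᶠ[𝓝 (φ g)] id := by
        filter_upwards [φ.open_target.mem_nhds (φ.map_source hg)] with e he using φ.right_inv he
      have h6 := hasMFDerivAt_unique (h4.congr_of_eventuallyEq h5.symm) (hasMFDerivAt_id _)
      exact congrArg (fun L : E →L[ℝ] E => L v) h6
    · have h4 := h2.comp g h1
      have h5 : φ.symm ∘ φ =ᶠ[𝓝 g] id := by
        filter_upwards [φ.open_source.mem_nhds hg] with e he using φ.left_inv he
      have h6 := hasMFDerivAt_unique (h4.congr_of_eventuallyEq h5.symm) (hasMFDerivAt_id _)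
      exact congrArg (fun L : E →L[ℝ] E => L v) h6
  have hD : ∀ y, y ∈ ψ.source → u y ∈ φ.source → ∃ A B : E →L[ℝ] E,
      HasMFDerivAt 𝓘(ℝ, E) 𝓘(ℝ, E) φ (u y) A ∧ (∀ v, A (B v) = v) ∧ (∀ v, B (A v) = v) ∧
        (∀ e : K, mfderiv 𝓘(ℝ, K) 𝓘(ℝ, E) (k y) (0 : K) e = B (T.symm (0, e))) ∧
        ∀ v : E, mfderiv 𝓘(ℝ, E) 𝓘(ℝ, K) p (u y) v = (T (A v)).2 := by
    intro y hy huy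
    obtain ⟨A, B, hA, hB, hAB, hBA⟩ := hA _ huy
    refine ⟨A, B, hA, hAB, hBA, fun e => ?_, fun v => ?_⟩
    · have h1 : HasFDerivAt (c y)
          ((T.symm : F × K →L[ℝ] E) ∘L ContinuousLinearMap.inr ℝ F K) (0 : K) := by
        have h2 : HasFDerivAt (fun e : K => ((ψ y, p (u y) + e) : F × K))
            (ContinuousLinearMap.inr ℝ F K) 0 := by
          exact (hasFDerivAt_const (𝕜 := ℝ) (ψ y) (0 : K)).prodMk
            ((hasFDerivAt_id (𝕜 := ℝ) (0 : K)).const_add (p (u y)))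
        exact T.symm.hasFDerivAt.comp (0 : K) h2
      have h2 : HasMFDerivAt 𝓘(ℝ, E) 𝓘(ℝ, E) φ.symm (c y 0) B := by rw [hc0 y huy]; exact hB
      have h3 := h2.comp (0 : K) h1.hasMFDerivAt
      rw [show k y = φ.symm ∘ c y from rfl, h3.mfderiv]
      rfl
    · have h1 : HasFDerivAt (fun e => (T e).2)
          ((ContinuousLinearMap.snd ℝ F K) ∘L (T : E →L[ℝ] F × K)) (φ (u y)) :=
        (ContinuousLinearMap.hasFDerivAt (ContinuousLinearMap.snd ℝ F K)).comp _ T.hasFDerivAt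
      have h3 := h1.hasMFDerivAt.comp (u y) hA
      rw [show p = (fun e => (T e).2) ∘ φ from rfl, h3.mfderiv]
      rfl
  -- Vectors killed by the derivative of `f` have no `F`-component in the charts, so `p` loses
  -- nothing on them.
  have hkern : ∀ y, y ∈ ψ.source → u y ∈ φ.source → ∀ A : E →L[ℝ] E,
      HasMFDerivAt 𝓘(ℝ, E) 𝓘(ℝ, E) φ (u y) A → ∀ v : E,
      mfderiv 𝓘(ℝ, E) 𝓘(ℝ, F) f (u y) v = (0 : F) → (T (A v)).1 = 0 := by
    intro y hy huy A hA v hv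
    have h1 : HasFDerivAt (fun e => (T e).1)
        ((ContinuousLinearMap.fst ℝ F K) ∘L (T : E →L[ℝ] F × K)) (φ (u y)) :=
      (ContinuousLinearMap.hasFDerivAt (ContinuousLinearMap.fst ℝ F K)).comp _ T.hasFDerivAt
    have h2 := h1.hasMFDerivAt.comp (u y) hA
    have h3 : HasMFDerivAt 𝓘(ℝ, E) 𝓘(ℝ, F) f (u y) (mfderiv 𝓘(ℝ, E) 𝓘(ℝ, F) f (u y)) :=
      ((hf.contMDiffOn.contMDiffAt (φ.open_source.mem_nhds huy)).mdifferentiableAt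
        (by simp)).hasMFDerivAt
    have h4 := ((hψd (f (u y)) (hsub _ huy)).mdifferentiableAt (by simp)).hasMFDerivAt.comp (u y) h3
    have h5 : ψ ∘ f =ᶠ[𝓝 (u y)] (fun e => (T e).1) ∘ φ := by
      filter_upwards [φ.open_source.mem_nhds huy] with g hg using hw g hg
    have h6 := hasMFDerivAt_unique (h2.congr_of_eventuallyEq h5) h4
    have h7 := congrArg (fun L : E →L[ℝ] F => L v) h6
    refine h7.trans ?_
    refine (congrArg (mfderiv 𝓘(ℝ, F) 𝓘(ℝ, F) ψ (f (u y))) hv).trans ?_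
    exact map_zero _
  refine ⟨⟨k, p, ?_, ?_, ?_, ?_, ?_, ?_⟩⟩
  · filter_upwards [huy] with y hy
    change φ.symm (c y 0) = u y
    rw [hc0 y hy, φ.left_inv hy]
  · have h1 : Filter.Tendsto (fun z : M × K => z.1) (𝓝 (x, (0 : K))) (𝓝 x) := continuousAt_fst
    have h2 : ContinuousAt (Function.uncurry c) (x, 0) := (hc x hx hux 0).continuousAt
    have h3 : ∀ᶠ z in 𝓝 (x, (0 : K)), c z.1 z.2 ∈ φ.target := by
      refine h2 (φ.open_target.mem_nhds ?_)
      change c x 0 ∈ φ.target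
      rw [hc0 x hux]
      exact φ.map_source hux
    filter_upwards [h1.eventually hψy, h3] with z hz1 hz2
    have h4 := hw _ (φ.map_target hz2)
    rw [φ.right_inv hz2] at h4
    simp only [c, ContinuousLinearEquiv.apply_symm_apply] at h4
    exact ψ.injOn (hsub _ (φ.map_target hz2)) hz1 h4
  · filter_upwards [huy, hψy] with y h1 h2
    refine ContMDiffAt.comp (y, (0 : K)) (g := φ.symm) ?_ (hc y h2 h1 0)
    refine hφs _ ?_
    change c y 0 ∈ φ.target
    rw [hc0 y h1]
    exact φ.map_source h1
  · filter_upwards [φ.open_source.mem_nhds hux] with g hg using hp g hg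
  · filter_upwards [huy, hψy] with y h1 h2 v hv
    obtain ⟨A, B, hA, hAB, hBA, hk, hp⟩ := hD y h2 h1
    have h3 := hkern y h2 h1 A hA v hv
    refine (hk _).trans ?_
    rw [hp v]
    rw [show ((0 : F), (T (A v)).2) = T (A v) from Prod.ext h3.symm rfl,
      ContinuousLinearEquiv.symm_apply_apply, hBA]
  · filter_upwards [huy, hψy] with y h1 h2 e
    obtain ⟨A, B, hA, hAB, hBA, hk, hp⟩ := hD y h2 h1
    refine (hp _).trans ?_
    rw [hk e, hAB, ContinuousLinearEquiv.apply_symm_apply]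

namespace FiberParam

variable {K : Type*} [NormedAddCommGroup K] [NormedSpace ℝ K] {f : G → M} {u : M → G} {x : M}
  (Φ : FiberParam (E := E) (F := F) K f u x)

theorem eventually_f_k : ∀ᶠ y in 𝓝 x, ∀ᶠ z in 𝓝 (y, (0 : K)), f (Φ.k z.1 z.2) = z.1 := by
  have h1 : Filter.Tendsto (fun y : M => (y, (0 : K))) (𝓝 x) (𝓝 (x, 0)) :=
    (Continuous.prodMk_left (0 : K)).continuousAt
  exact h1.eventually Φ.f_k.eventually_nhds

theorem eventually_f_k_apply : ∀ᶠ y in 𝓝 x, ∀ᶠ e in 𝓝 (0 : K), f (Φ.k y e) = y := by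
  filter_upwards [Φ.eventually_f_k] with y hy
  have h1 : Filter.Tendsto (fun e : K => (y, e)) (𝓝 0) (𝓝 (y, 0)) :=
    (Continuous.prodMk_right y).continuousAt
  exact h1.eventually hy

theorem eventually_mdifferentiableAt_k :
    ∀ᶠ y in 𝓝 x, MDifferentiableAt 𝓘(ℝ, K) 𝓘(ℝ, E) (Φ.k y) 0 := by
  filter_upwards [Φ.contMDiffAt_k] with y hy
  have h1 : ContMDiffAt 𝓘(ℝ, K) (𝓘(ℝ, F).prod 𝓘(ℝ, K)) ∞ (fun e : K => (y, e)) 0 :=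
    contMDiffAt_const.prodMk contMDiffAt_id
  exact (hy.comp (0 : K) h1).mdifferentiableAt (by simp)

end FiberParam

end Submersion

/-- Every tangent space is definitionally the model `E`, so vectors over propositionally equal
points can be compared there without casts. This handles base points such as `mul (unit (tgt g)) g`
and `g`. -/
theorem tangentBundle_mk_congr {E B : Type*} [NormedAddCommGroup E] [NormedSpace ℝ E]
    [TopologicalSpace B] [ChartedSpace E B] {b b' : B} (h : b = b')
    {v : TangentSpace 𝓘(ℝ, E) b} {w : TangentSpace 𝓘(ℝ, E) b'} (hvw : (v : E) = (w : E)) :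
    (⟨b, v⟩ : TangentBundle 𝓘(ℝ, E) B) = ⟨b', w⟩ := by
  subst h
  exact congrArg (Bundle.TotalSpace.mk b) hvw

universe u

/-! ### Right translation, right-invariant vector fields and their brackets -/

namespace LieGroupoid

variable {E : Type u} {F : Type*} [NormedAddCommGroup E] [NormedSpace ℝ E]
  [NormedAddCommGroup F] [NormedSpace ℝ F]
  {G M : Type*} [TopologicalSpace G] [ChartedSpace E G] [TopologicalSpace M] [ChartedSpace F M]
  (𝒢 : LieGroupoid E F G M)

theorem contMDiff_src : ContMDiff 𝓘(ℝ, E) 𝓘(ℝ, F) ∞ 𝒢.src := 𝒢.isSubmersion_src.contMDiff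

theorem contMDiff_tgt : ContMDiff 𝓘(ℝ, E) 𝓘(ℝ, F) ∞ 𝒢.tgt := 𝒢.isSubmersion_tgt.contMDiff

theorem mdifferentiableWithinAt_mul_right (g : G) :
    MDifferentiableWithinAt 𝓘(ℝ, E) 𝓘(ℝ, E) (fun h => 𝒢.mul h g) (𝒢.src ⁻¹' {𝒢.tgt g})
      (𝒢.unit (𝒢.tgt g)) := by
  have h1 := 𝒢.contMDiffOn_mul (𝒢.unit (𝒢.tgt g), g) (𝒢.src_unit _)
  have h2 : ContMDiff 𝓘(ℝ, E) (𝓘(ℝ, E).prod 𝓘(ℝ, E)) ∞ (fun h : G => (h, g)) :=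
    contMDiff_id.prodMk contMDiff_const
  have h3 := h1.comp (𝒢.unit (𝒢.tgt g)) (h2.contMDiffAt.contMDiffWithinAt
    (s := 𝒢.src ⁻¹' {𝒢.tgt g})) (fun h hh => hh)
  exact h3.mdifferentiableWithinAt (by simp)

section Parametrized

variable {K : Type*} [NormedAddCommGroup K] [NormedSpace ℝ K]

/-- The differential of the right translation by `g` computed on a parametrized family of elements
of the source fiber. -/
theorem dRight_eq_mfderiv {g : G} {a : 𝒢.algFiber (𝒢.tgt g)} {c : K → G}
    (h0 : c 0 = 𝒢.unit (𝒢.tgt g)) (hs : ∀ᶠ e in 𝓝 0, 𝒢.src (c e) = 𝒢.tgt g)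
    (hc : MDifferentiableAt 𝓘(ℝ, K) 𝓘(ℝ, E) c 0) {e : K}
    (ha : (mfderiv 𝓘(ℝ, K) 𝓘(ℝ, E) c (0 : K) e : E) = a.1) :
    (𝒢.dRight g a : E) = mfderiv 𝓘(ℝ, K) 𝓘(ℝ, E) (fun e => 𝒢.mul (c e) g) (0 : K) e := by
  -- A derivative within the fiber need not be unique in transverse directions. Any choice obeys the
  -- chain rule along `c`, which forces its value on the vectors tangent to `c`.
  have h1 := (𝒢.mdifferentiableWithinAt_mul_right g).hasMFDerivWithinAt
  set D : E →L[ℝ] E := mfderivWithin 𝓘(ℝ, E) 𝓘(ℝ, E) (fun h => 𝒢.mul h g)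
    (𝒢.src ⁻¹' {𝒢.tgt g}) (𝒢.unit (𝒢.tgt g)) with hD
  have h2 : HasMFDerivWithinAt 𝓘(ℝ, E) 𝓘(ℝ, E) (fun h => 𝒢.mul h g)
    (𝒢.src ⁻¹' {𝒢.tgt g}) (c 0) D := by rw [h0]; exact h1
  -- Near `0` the curve family `c` stays in the fiber, so the composite is differentiable in the
  -- ordinary sense.
  have h3 := h2.comp (0 : K) (hc.hasMFDerivAt.hasMFDerivWithinAt
    (s := c ⁻¹' (𝒢.src ⁻¹' {𝒢.tgt g}))) subset_rfl
  have h4 := h3.hasMFDerivAt hs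
  have h5 := h4.mfderiv
  have h6 := congrArg (fun L : K →L[ℝ] E => L e) h5
  refine Eq.trans ?_ h6.symm
  exact congrArg D ha.symm

end Parametrized

theorem exists_fiberParam (x : M) : ∃ (K : Type u) (_ : NormedAddCommGroup K)
    (_ : NormedSpace ℝ K), Nonempty (FiberParam (E := E) (F := F) K 𝒢.src 𝒢.unit x) :=
  ⟨_, _, _, (𝒢.isSubmersion_src.isSubmersionAt (𝒢.unit x)).exists_fiberParam
    𝒢.contMDiff_unit 𝒢.src_unit⟩

section Parametrized

variable {K : Type*} [NormedAddCommGroup K] [NormedSpace ℝ K] {𝒢}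
  {x : M} (Φ : FiberParam (E := E) (F := F) K 𝒢.src 𝒢.unit x)

theorem eventually_contMDiffAt_mul_fiberParam {g : G} (hg : 𝒢.tgt g = x) :
    ∀ᶠ h in 𝓝 g, ContMDiffAt (𝓘(ℝ, E).prod 𝓘(ℝ, K)) 𝓘(ℝ, E) ∞
      (Function.uncurry fun (h : G) (e : K) => 𝒢.mul (Φ.k (𝒢.tgt h) e) h) (h, 0) := by
  have ht : Filter.Tendsto 𝒢.tgt (𝓝 g) (𝓝 x) := hg ▸ 𝒢.contMDiff_tgt.continuous.continuousAt
  filter_upwards [ht.eventually Φ.contMDiffAt_k, ht.eventually Φ.k_zero,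
    ht.eventually Φ.eventually_f_k] with h h1 h2 h3
  have h4 : ContMDiffAt (𝓘(ℝ, E).prod 𝓘(ℝ, K)) (𝓘(ℝ, F).prod 𝓘(ℝ, K)) ∞
      (fun z : G × K => (𝒢.tgt z.1, z.2)) (h, 0) :=
    (𝒢.contMDiff_tgt.contMDiffAt.comp (h, (0 : K)) contMDiffAt_fst).prodMk contMDiffAt_snd
  have h5 : ContMDiffAt (𝓘(ℝ, E).prod 𝓘(ℝ, K)) (𝓘(ℝ, E).prod 𝓘(ℝ, E)) ∞
      (fun z : G × K => (Φ.k (𝒢.tgt z.1) z.2, z.1)) (h, 0) :=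
    (ContMDiffAt.comp (h, (0 : K)) h1 h4).prodMk contMDiffAt_fst
  have h6 : ∀ᶠ z in 𝓝 (h, (0 : K)), 𝒢.src (Φ.k (𝒢.tgt z.1) z.2) = 𝒢.tgt z.1 :=
    h4.continuousAt.eventually h3
  have h7 := 𝒢.contMDiffOn_mul (Φ.k (𝒢.tgt h) 0, h) (by
    change 𝒢.src (Φ.k (𝒢.tgt h) 0) = 𝒢.tgt h
    exact h6.self_of_nhds)
  have h8 := h7.comp (h, (0 : K)) (h5.contMDiffWithinAt
    (s := {z : G × K | 𝒢.src (Φ.k (𝒢.tgt z.1) z.2) = 𝒢.tgt z.1})) (fun z hz => hz)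
  exact h8.contMDiffAt h6

/-- The neighborhood is taken in `M`, uniformly over all `g` with target `y`, so that the statement
can be pulled back along `tgt` near any arrow, not only near units. -/
theorem eventually_dRight_eq_mfderiv : ∀ᶠ y in 𝓝 x, ∀ (g : G), 𝒢.tgt g = y →
    ∀ (a : 𝒢.algFiber (𝒢.tgt g)) (e : K),
    (mfderiv 𝓘(ℝ, K) 𝓘(ℝ, E) (Φ.k y) (0 : K) e : E) = a.1 →
    (𝒢.dRight g a : E) = mfderiv 𝓘(ℝ, K) 𝓘(ℝ, E) (fun e => 𝒢.mul (Φ.k y e) g) (0 : K) e := by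
  filter_upwards [Φ.k_zero, Φ.eventually_f_k_apply, Φ.eventually_mdifferentiableAt_k]
    with y h1 h2 h3 g hg a e hae
  subst hg
  exact 𝒢.dRight_eq_mfderiv h1 h2 h3 hae

theorem eventually_dRight_eq_mfderiv_p : ∀ᶠ y in 𝓝 x, ∀ (g : G), 𝒢.tgt g = y →
    ∀ (a : 𝒢.algFiber (𝒢.tgt g)),
    (𝒢.dRight g a : E) = mfderiv 𝓘(ℝ, K) 𝓘(ℝ, E) (fun e => 𝒢.mul (Φ.k y e) g) (0 : K)
      (mfderiv 𝓘(ℝ, E) 𝓘(ℝ, K) Φ.p (𝒢.unit (𝒢.tgt g)) a.1 : K) := by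
  filter_upwards [eventually_dRight_eq_mfderiv Φ, Φ.deriv_k_p] with y h1 h2 g hg a
  refine h1 g hg a _ ?_
  subst hg
  exact h2 a.1 a.2

end Parametrized

variable [IsManifold 𝓘(ℝ, E) ∞ G] [IsManifold 𝓘(ℝ, F) ∞ M]

variable {𝒢} in
/-- Right-invariant vector fields of smooth sections are smooth. -/
theorem contMDiffAt_rightVectorField {X : ∀ x, 𝒢.algFiber x} (hX : 𝒢.algebroid.IsSection X)
    (g : G) : ContMDiffAt 𝓘(ℝ, E) 𝓘(ℝ, E).tangent ∞
      (fun g => (⟨g, 𝒢.rightVectorField X g⟩ : TangentBundle 𝓘(ℝ, E) G)) g := by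
  obtain ⟨K, _, _, ⟨Φ⟩⟩ := 𝒢.exists_fiberParam (𝒢.tgt g)
  have ht : Filter.Tendsto 𝒢.tgt (𝓝 g) (𝓝 (𝒢.tgt g)) := 𝒢.contMDiff_tgt.continuous.continuousAt
  have hX' : ContMDiffAt 𝓘(ℝ, E) 𝓘(ℝ, E).tangent ∞ (fun h => (⟨𝒢.unit (𝒢.tgt h), (X (𝒢.tgt h)).1⟩ :
      TangentBundle 𝓘(ℝ, E) G)) g :=
    (show ContMDiff 𝓘(ℝ, F) 𝓘(ℝ, E).tangent ∞ fun x => (⟨𝒢.unit x, (X x).1⟩ :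
      TangentBundle 𝓘(ℝ, E) G) from hX).contMDiffAt.comp g 𝒢.contMDiff_tgt.contMDiffAt
  -- The coordinates of `X` in `K` depend smoothly on the arrow; inserting them into the partial
  -- derivative of `(h, e) ↦ k(β(h), e) h` gives the right-invariant field.
  have h1 := ContMDiffAt.mfderiv_tangent_apply (f := fun (_ : G) => Φ.p) (x₀ := g)
    (ContMDiffAt.comp (g, 𝒢.unit (𝒢.tgt g)) Φ.contMDiffAt_p.self_of_nhds contMDiffAt_snd) hX'
  have h2 := (contMDiffAt_tangentBundle_model_iff.1 h1).2
  have h3 := ContMDiffAt.mfderiv_tangent_apply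
    (f := fun (h : G) (e : K) => 𝒢.mul (Φ.k (𝒢.tgt h) e) h) (x₀ := g) (b := fun _ => 0)
    (eventually_contMDiffAt_mul_fiberParam Φ rfl).self_of_nhds
    (contMDiffAt_tangentBundle_model_iff.2 ⟨contMDiffAt_const, h2⟩)
  refine h3.congr_of_eventuallyEq ?_
  filter_upwards [ht.eventually (eventually_dRight_eq_mfderiv_p Φ), ht.eventually Φ.k_zero]
    with h h4 h5
  refine tangentBundle_mk_congr ?_ (h4 h rfl _)
  rw [h5, 𝒢.unit_mul]

omit [IsManifold 𝓘(ℝ, E) ∞ G] [IsManifold 𝓘(ℝ, F) ∞ M] in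
theorem dRight_unit (x : M) (a : 𝒢.algFiber (𝒢.tgt (𝒢.unit x))) :
    (𝒢.dRight (𝒢.unit x) a : E) = a.1 := by
  obtain ⟨K, _, _, ⟨Φ⟩⟩ := 𝒢.exists_fiberParam x
  have hx := 𝒢.tgt_unit x
  have h1 := (eventually_dRight_eq_mfderiv_p Φ).self_of_nhds (𝒢.unit x) hx a
  refine h1.trans ?_
  have h2 : (fun e => 𝒢.mul (Φ.k x e) (𝒢.unit x)) =ᶠ[𝓝 0] Φ.k x := by
    filter_upwards [Φ.eventually_f_k_apply.self_of_nhds] with e he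
    have := 𝒢.mul_unit (Φ.k x e)
    rwa [he] at this
  have h3 : mfderiv 𝓘(ℝ, K) 𝓘(ℝ, E) (fun e => 𝒢.mul (Φ.k x e) (𝒢.unit x)) (0 : K)
    = (mfderiv 𝓘(ℝ, K) 𝓘(ℝ, E) (Φ.k x) (0 : K) : K →L[ℝ] E) := h2.mfderiv_eq
  have h4 : ∀ y, y = x → ∀ a : 𝒢.algFiber y, mfderiv 𝓘(ℝ, K) 𝓘(ℝ, E) (Φ.k x) (0 : K)
      (mfderiv 𝓘(ℝ, E) 𝓘(ℝ, K) Φ.p (𝒢.unit y) a.1 : K) = (a.1 : E) := by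
    rintro y rfl a
    exact Φ.deriv_k_p.self_of_nhds a.1 a.2
  exact (congrArg (fun L : K →L[ℝ] E => L _) h3).trans (h4 _ hx a)

omit [IsManifold 𝓘(ℝ, E) ∞ G] [IsManifold 𝓘(ℝ, F) ∞ M] in
-- The source of `hg` is the source of `g`, hence constant along the parametrized fiber.
theorem mfderiv_src_dRight (g : G) (a : 𝒢.algFiber (𝒢.tgt g)) :
    mfderiv 𝓘(ℝ, E) 𝓘(ℝ, F) 𝒢.src g (𝒢.dRight g a) = 0 := by
  obtain ⟨K, _, _, ⟨Φ⟩⟩ := 𝒢.exists_fiberParam (𝒢.tgt g)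
  have h1 := (eventually_dRight_eq_mfderiv_p Φ).self_of_nhds g rfl a
  have h2 := (eventually_contMDiffAt_mul_fiberParam Φ rfl).self_of_nhds
  set m : K → G := fun e => 𝒢.mul (Φ.k (𝒢.tgt g) e) g
  have h3 : MDifferentiableAt 𝓘(ℝ, K) 𝓘(ℝ, E) m 0 := by
    have h4 : ContMDiffAt 𝓘(ℝ, K) (𝓘(ℝ, E).prod 𝓘(ℝ, K)) ∞ (fun e : K => (g, e)) 0 :=
      contMDiffAt_const.prodMk contMDiffAt_id
    exact (h2.comp (0 : K) h4).mdifferentiableAt (by simp)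
  have hm0 : m 0 = g := by
    simp only [m]
    rw [Φ.k_zero.self_of_nhds, 𝒢.unit_mul]
  have h5 : HasMFDerivAt 𝓘(ℝ, E) 𝓘(ℝ, F) 𝒢.src (m 0)
      (mfderiv 𝓘(ℝ, E) 𝓘(ℝ, F) 𝒢.src g : E →L[ℝ] F) := by
    rw [hm0]
    exact (𝒢.contMDiff_src.mdifferentiableAt (by simp)).hasMFDerivAt
  have h6 := h5.comp (0 : K) h3.hasMFDerivAt
  have h7 : 𝒢.src ∘ m =ᶠ[𝓝 0] fun _ => 𝒢.src g := by
    filter_upwards [Φ.eventually_f_k_apply.self_of_nhds] with e he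
    exact 𝒢.src_mul _ _ he
  have h8 := hasMFDerivAt_unique (h6.congr_of_eventuallyEq h7.symm) (hasMFDerivAt_const _ _)
  refine (congrArg (mfderiv 𝓘(ℝ, E) 𝓘(ℝ, F) 𝒢.src g) h1).trans ?_
  exact congrArg (fun L : K →L[ℝ] F => L _) h8

variable {𝒢} in
theorem mlieBracket_rightVectorField_mem [CompleteSpace E] {X Y : ∀ x, 𝒢.algFiber x}
    (hX : 𝒢.algebroid.IsSection X) (hY : 𝒢.algebroid.IsSection Y) (x : M) :
    VectorField.mlieBracket 𝓘(ℝ, E) (𝒢.rightVectorField X) (𝒢.rightVectorField Y) (𝒢.unit x)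
      ∈ 𝒢.algFiber x :=
  mfderiv_mlieBracket_eq_zero 𝒢.contMDiff_src.contMDiffAt (contMDiffAt_rightVectorField hX _)
    (contMDiffAt_rightVectorField hY _) (.of_forall fun _ => 𝒢.mfderiv_src_dRight _ _)
    (.of_forall fun _ => 𝒢.mfderiv_src_dRight _ _)

/-- `T(1 ∘ α)` factors through `Tα`, which kills `v`. -/
theorem algProj_of_mem {x : M} {v : TangentSpace 𝓘(ℝ, E) (𝒢.unit x)} (hv : v ∈ 𝒢.algFiber x) :
    (𝒢.algProj x v).1 = v := by
  have h1 : HasMFDerivAt 𝓘(ℝ, F) 𝓘(ℝ, E) 𝒢.unit (𝒢.src (𝒢.unit x))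
      (mfderiv 𝓘(ℝ, F) 𝓘(ℝ, E) 𝒢.unit (𝒢.src (𝒢.unit x))) :=
    (𝒢.contMDiff_unit.mdifferentiableAt (by simp)).hasMFDerivAt
  have h2 := h1.comp (𝒢.unit x) (𝒢.contMDiff_src.mdifferentiableAt (by simp)).hasMFDerivAt
  have h3 : 𝒢.unitSrcDeriv x v = 0 := by
    refine (congrArg (fun L : E →L[ℝ] E => L v) h2.mfderiv).trans ?_
    refine (congrArg (mfderiv 𝓘(ℝ, F) 𝓘(ℝ, E) 𝒢.unit (𝒢.src (𝒢.unit x))) hv).trans ?_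
    exact map_zero _
  change v - 𝒢.unitSrcDeriv x v = v
  rw [h3, sub_zero]

variable {𝒢} in
theorem coe_bracket [CompleteSpace E] {X Y : ∀ x, 𝒢.algFiber x}
    (hX : 𝒢.algebroid.IsSection X) (hY : 𝒢.algebroid.IsSection Y) (x : M) :
    (𝒢.algebroid.bracket X Y x).1 = VectorField.mlieBracket 𝓘(ℝ, E) (𝒢.rightVectorField X)
      (𝒢.rightVectorField Y) (𝒢.unit x) :=
  𝒢.algProj_of_mem (mlieBracket_rightVectorField_mem hX hY x)

end LieGroupoid

/-! ### Smooth operator families and bump functions -/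

section Smoothness

theorem contMDiffAt_clm_of_apply {EN HN N : Type*} [NormedAddCommGroup EN] [NormedSpace ℝ EN]
    [TopologicalSpace HN] {J : ModelWithCorners ℝ EN HN} [TopologicalSpace N] [ChartedSpace HN N]
    {K V : Type*} [NormedAddCommGroup K] [NormedSpace ℝ K] [FiniteDimensional ℝ K]
    [NormedAddCommGroup V] [NormedSpace ℝ V] {T : N → K →L[ℝ] V} {x : N}
    (h : ∀ e, ContMDiffAt J 𝓘(ℝ, V) ∞ (fun y => T y e) x) :
    ContMDiffAt J 𝓘(ℝ, K →L[ℝ] V) ∞ T x := by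
  let b := Module.finBasis ℝ K
  let c : ∀ i, K →L[ℝ] ℝ := fun i => LinearMap.toContinuousLinearMap (b.coord i)
  have h1 : T = fun y => ∑ i, ContinuousLinearMap.smulRightL ℝ K V (c i) (T y (b i)) := by
    funext y
    ext e
    have h2 := congrArg (T y) (b.sum_repr e)
    rw [map_sum] at h2
    simp only [map_smul] at h2
    simpa [c] using h2.symm
  rw [h1]
  refine contMDiffAt_finsetSum fun i _ => ?_
  exact ((ContinuousLinearMap.smulRightL ℝ K V (c i)).contMDiff.contMDiffAt).comp x (h (b i))

variable {E B : Type*} [NormedAddCommGroup E] [NormedSpace ℝ E] [FiniteDimensional ℝ E]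
  [TopologicalSpace B] [T2Space B] [ChartedSpace E B] [IsManifold 𝓘(ℝ, E) ∞ B]

omit [IsManifold 𝓘(ℝ, E) ∞ B] in
theorem SmoothBumpFunction.exists_tsupport_subset {x : B} {s : Set B} (hs : s ∈ 𝓝 x) :
    ∃ ρ : SmoothBumpFunction 𝓘(ℝ, E) x, tsupport ρ ⊆ s := by
  obtain ⟨ρ, -, h⟩ := (SmoothBumpFunction.nhds_basis_tsupport (I := 𝓘(ℝ, E)) x).mem_iff.1 hs
  exact ⟨ρ, h⟩

theorem SmoothBumpFunction.contMDiff_mul {x : B} (ρ : SmoothBumpFunction 𝓘(ℝ, E) x) {h : B → ℝ}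
    (hh : ∀ y ∈ tsupport ρ, ContMDiffAt 𝓘(ℝ, E) 𝓘(ℝ, ℝ) ∞ h y) :
    ContMDiff 𝓘(ℝ, E) 𝓘(ℝ, ℝ) ∞ fun y => ρ y * h y := by
  intro y
  by_cases hy : y ∈ tsupport ρ
  · exact ρ.contMDiffAt.mul (hh y hy)
  · refine (contMDiffAt_const (c := (0 : ℝ))).congr_of_eventuallyEq ?_
    filter_upwards [notMem_tsupport_iff_eventuallyEq.1 hy] with z hz
    rw [hz, Pi.zero_apply, zero_mul]

end Smoothness

theorem contMDiffAt_of_isSection {E B : Type*} [NormedAddCommGroup E] [NormedSpace ℝ E]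
    [TopologicalSpace B] [ChartedSpace E B] [IsManifold 𝓘(ℝ, E) ∞ B]
    {V : ∀ b : B, TangentSpace 𝓘(ℝ, E) b} (hV : (tangentAlgebroid E B).IsSection V) (b : B) :
    ContMDiffAt 𝓘(ℝ, E) 𝓘(ℝ, E).tangent ∞ (fun b => (⟨b, V b⟩ : TangentBundle 𝓘(ℝ, E) B)) b :=
  hV b

section FiberParam

variable {E F : Type*} [NormedAddCommGroup E] [NormedSpace ℝ E] [FiniteDimensional ℝ E]
  [NormedAddCommGroup F] [NormedSpace ℝ F]
  {G M : Type*} [TopologicalSpace G] [ChartedSpace E G]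
  [TopologicalSpace M] [ChartedSpace F M]
  {K : Type*} [NormedAddCommGroup K] [NormedSpace ℝ K] {f : G → M} {u : M → G} {x : M}

/-- The derivative of `k x` embeds `K` in `E`, with the derivative of `p` as left inverse. -/
theorem FiberParam.finiteDimensional (Φ : FiberParam (E := E) (F := F) K f u x) :
    FiniteDimensional ℝ K := by
  let D : K →L[ℝ] E := mfderiv 𝓘(ℝ, K) 𝓘(ℝ, E) (Φ.k x) (0 : K)
  refine FiniteDimensional.of_injective (D : K →ₗ[ℝ] E) ?_
  exact Function.LeftInverse.injective
    (g := fun v => (mfderiv 𝓘(ℝ, E) 𝓘(ℝ, K) Φ.p (u x) : E →L[ℝ] K) v) Φ.deriv_p_k.self_of_nhds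

end FiberParam

/-! ### Extending one-forms from the Lie algebroid to the groupoid -/

namespace LieGroupoid

variable {E : Type u} {F : Type*} [NormedAddCommGroup E] [NormedSpace ℝ E]
  [NormedAddCommGroup F] [NormedSpace ℝ F]
  {G M : Type*} [TopologicalSpace G] [ChartedSpace E G] [TopologicalSpace M] [ChartedSpace F M]
  {𝒢 : LieGroupoid E F G M}

section Parametrized

variable {K : Type*} [NormedAddCommGroup K] [NormedSpace ℝ K] {x : M}
  (Φ : FiberParam (E := E) (F := F) K 𝒢.src 𝒢.unit x)

theorem eventually_mfderiv_k_mem : ∀ᶠ y in 𝓝 x, ∀ e : K,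
    (mfderiv 𝓘(ℝ, K) 𝓘(ℝ, E) (Φ.k y) (0 : K) e : E) ∈ 𝒢.algFiber y := by
  filter_upwards [Φ.k_zero, Φ.eventually_f_k_apply, Φ.eventually_mdifferentiableAt_k]
    with y h1 h2 h3 e
  have h5 : HasMFDerivAt 𝓘(ℝ, E) 𝓘(ℝ, F) 𝒢.src (Φ.k y 0)
      (mfderiv 𝓘(ℝ, E) 𝓘(ℝ, F) 𝒢.src (𝒢.unit y) : E →L[ℝ] F) := by
    rw [h1]
    exact (𝒢.contMDiff_src.mdifferentiableAt (by simp)).hasMFDerivAt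
  have h6 := h5.comp (0 : K) h3.hasMFDerivAt
  have h7 : 𝒢.src ∘ Φ.k y =ᶠ[𝓝 0] fun _ => y := h2
  have h8 := hasMFDerivAt_unique (h6.congr_of_eventuallyEq h7.symm) (hasMFDerivAt_const _ _)
  exact congrArg (fun L : K →L[ℝ] F => L e) h8

variable [IsManifold 𝓘(ℝ, E) ∞ G] [IsManifold 𝓘(ℝ, F) ∞ M]

/-- The local sections of `AG` defined by a parametrization of the source fibers extend to global
smooth sections. -/
theorem exists_isSection_eq_mfderiv_k [FiniteDimensional ℝ F] [T2Space M] (e : K) :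
    ∃ S : ∀ y, 𝒢.algFiber y, 𝒢.algebroid.IsSection S ∧
      ∀ᶠ y in 𝓝 x, ((S y).1 : E) = mfderiv 𝓘(ℝ, K) 𝓘(ℝ, E) (Φ.k y) (0 : K) e := by
  classical
  have hev := (eventually_mfderiv_k_mem Φ).and (Φ.k_zero.and Φ.contMDiffAt_k)
  obtain ⟨ρ, hρ⟩ := SmoothBumpFunction.exists_tsupport_subset (E := F) hev.eventually_nhds
  -- Away from `x` the derivative need not lie in `A_y G`; the default `0` is harmless because the
  -- support of `ρ` avoids such points.
  let S : ∀ y, 𝒢.algFiber y := fun y =>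
    if h : (mfderiv 𝓘(ℝ, K) 𝓘(ℝ, E) (Φ.k y) (0 : K) e : E) ∈ 𝒢.algFiber y then ρ y • ⟨_, h⟩ else 0
  refine ⟨S, fun y => ?_, ?_⟩
  · by_cases hy : y ∈ tsupport ρ
    · have h1 := hρ hy
      have h2 := ContMDiffAt.mfderiv_tangent_apply (f := Φ.k) (b := fun _ => (0 : K))
        (v := fun _ => e) (x₀ := y) h1.self_of_nhds.2.2
        (contMDiffAt_tangentBundle_model_iff.2 ⟨contMDiffAt_const, contMDiffAt_const⟩)
      have h3 := contMDiffAt_tangent_smul (f := ρ) ρ.contMDiffAt h2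
      refine h3.congr_of_eventuallyEq ?_
      filter_upwards [h1] with z hz
      refine tangentBundle_mk_congr hz.2.1.symm ?_
      simp only [S, dif_pos (hz.1 e)]
      rfl
    · refine (contMDiffAt_tangent_zero 𝒢.contMDiff_unit.contMDiffAt).congr_of_eventuallyEq ?_
      filter_upwards [notMem_tsupport_iff_eventuallyEq.1 hy] with z hz
      refine tangentBundle_mk_congr rfl ?_
      have : S z = 0 := by
        simp only [S, hz, Pi.zero_apply, zero_smul, dite_eq_ite, ite_self]
      rw [this]
      rfl
  · filter_upwards [hev, ρ.eventuallyEq_one] with y hy h1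
    simp only [S, dif_pos (hy.1 e), h1, Pi.one_apply, one_smul]
    rfl

/-- The right translates of the vectors tangent to a parametrization of the source fibers, read
through the map `p` of the parametrization. -/
noncomputable def transition (g : G) : K →L[ℝ] K :=
  (mfderiv 𝓘(ℝ, E) 𝓘(ℝ, K) Φ.p g : E →L[ℝ] K) ∘L
    (mfderiv 𝓘(ℝ, K) 𝓘(ℝ, E) (fun e => 𝒢.mul (Φ.k (𝒢.tgt g) e) g) (0 : K) : K →L[ℝ] E)

omit [IsManifold 𝓘(ℝ, E) ∞ G] [IsManifold 𝓘(ℝ, F) ∞ M] in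
theorem tendsto_tgt_unit : Filter.Tendsto 𝒢.tgt (𝓝 (𝒢.unit x)) (𝓝 x) := by
  have h := 𝒢.contMDiff_tgt.continuous.continuousAt (x := 𝒢.unit x)
  rwa [ContinuousAt, 𝒢.tgt_unit] at h

omit [IsManifold 𝓘(ℝ, F) ∞ M] in
-- One neighborhood serves all vector fields `V`, so a bump function can be fixed before the form is
-- tested on a field.
theorem eventually_contMDiffAt_p_apply :
    ∀ᶠ g in 𝓝 (𝒢.unit x), ∀ V : ∀ g : G, TangentSpace 𝓘(ℝ, E) g,
      ContMDiffAt 𝓘(ℝ, E) 𝓘(ℝ, E).tangent ∞ (fun g => (⟨g, V g⟩ : TangentBundle 𝓘(ℝ, E) G)) g →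
      ContMDiffAt 𝓘(ℝ, E) 𝓘(ℝ, K) ∞ (fun g => (mfderiv 𝓘(ℝ, E) 𝓘(ℝ, K) Φ.p g (V g) : K)) g := by
  filter_upwards [Φ.contMDiffAt_p] with g h V hV
  have h1 := ContMDiffAt.mfderiv_tangent_apply (f := fun (_ : G) => Φ.p) (x₀ := g)
    (ContMDiffAt.comp (g, g) h contMDiffAt_snd) hV
  exact (contMDiffAt_tangentBundle_model_iff.1 h1).2

omit [IsManifold 𝓘(ℝ, F) ∞ M] in
theorem eventually_contMDiffAt_transition [FiniteDimensional ℝ K] :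
    ∀ᶠ g in 𝓝 (𝒢.unit x), ContMDiffAt 𝓘(ℝ, E) 𝓘(ℝ, K →L[ℝ] K) ∞ (transition Φ) g := by
  filter_upwards [eventually_contMDiffAt_p_apply Φ,
    eventually_contMDiffAt_mul_fiberParam Φ (𝒢.tgt_unit x),
    (tendsto_tgt_unit.eventually Φ.k_zero).eventually_nhds] with g h1 h2 h3
  refine contMDiffAt_clm_of_apply fun e => h1 _ ?_
  have h4 := ContMDiffAt.mfderiv_tangent_apply
    (f := fun (h : G) (e : K) => 𝒢.mul (Φ.k (𝒢.tgt h) e) h) (x₀ := g) (b := fun _ => 0) h2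
    (contMDiffAt_tangentBundle_model_iff.2 ⟨contMDiffAt_const, contMDiffAt_const (c := e)⟩)
  refine h4.congr_of_eventuallyEq ?_
  filter_upwards [h3] with h h5
  refine tangentBundle_mk_congr ?_ rfl
  rw [h5, 𝒢.unit_mul]

omit [IsManifold 𝓘(ℝ, E) ∞ G] [IsManifold 𝓘(ℝ, F) ∞ M] in
theorem transition_unit : transition Φ (𝒢.unit x) = ContinuousLinearMap.id ℝ K := by
  ext e
  have h1 := 𝒢.tgt_unit x
  have h2 : (fun e => 𝒢.mul (Φ.k (𝒢.tgt (𝒢.unit x)) e) (𝒢.unit x)) =ᶠ[𝓝 0] Φ.k x := by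
    filter_upwards [Φ.eventually_f_k_apply.self_of_nhds] with e he
    have := 𝒢.mul_unit (Φ.k x e)
    rw [he] at this
    rw [h1]
    exact this
  have h3 : mfderiv 𝓘(ℝ, K) 𝓘(ℝ, E)
      (fun e => 𝒢.mul (Φ.k (𝒢.tgt (𝒢.unit x)) e) (𝒢.unit x)) (0 : K)
    = (mfderiv 𝓘(ℝ, K) 𝓘(ℝ, E) (Φ.k x) (0 : K) : K →L[ℝ] E) := h2.mfderiv_eq
  refine Eq.trans ?_ (Φ.deriv_p_k.self_of_nhds e)
  exact congrArg (fun L : K →L[ℝ] E => (mfderiv 𝓘(ℝ, E) 𝓘(ℝ, K) Φ.p (𝒢.unit x) : E →L[ℝ] K) (L e)) h3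

omit [IsManifold 𝓘(ℝ, F) ∞ M] in
-- The transition is the identity at `1_x` and continuous there, and invertible operators form a
-- neighborhood of the identity.
theorem eventually_transition_mem [FiniteDimensional ℝ K] :
    ∀ᶠ g in 𝓝 (𝒢.unit x), transition Φ g ∈ Set.range ((↑) : (K ≃L[ℝ] K) → K →L[ℝ] K) := by
  have h1 := (eventually_contMDiffAt_transition Φ).self_of_nhds.continuousAt
  refine h1 ?_
  rw [transition_unit]
  exact ContinuousLinearEquiv.nhds (ContinuousLinearEquiv.refl ℝ K)

end Parametrized

variable [IsManifold 𝓘(ℝ, E) ∞ G] [IsManifold 𝓘(ℝ, F) ∞ M]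

/-- A smooth 1-form `α` on `AG` extends to a smooth 1-form on `G` whose restriction to the source
fibers is, near a given unit, the right-invariant form defined by `α`. -/
theorem exists_isForm_eq_dRight [FiniteDimensional ℝ E] [FiniteDimensional ℝ F] [T2Space G]
    [T2Space M] {α : ∀ y, Module.Dual ℝ (𝒢.algFiber y)} (hα : 𝒢.algebroid.IsForm α) (x : M) :
    ∃ ξ : ∀ g : G, Module.Dual ℝ (TangentSpace 𝓘(ℝ, E) g), (tangentAlgebroid E G).IsForm ξ ∧
      ∀ᶠ g in 𝓝 (𝒢.unit x), ∀ a, ξ g (𝒢.dRight g a) = α (𝒢.tgt g) a := by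
  obtain ⟨K, _, _, ⟨Φ⟩⟩ := 𝒢.exists_fiberParam x
  have : FiniteDimensional ℝ K := Φ.finiteDimensional
  let b := Module.finBasis ℝ K
  choose S hS hSk using fun i => exists_isSection_eq_mfderiv_k Φ (b i)
  let D : ∀ g : G, E →L[ℝ] K := fun g => mfderiv 𝓘(ℝ, E) 𝓘(ℝ, K) Φ.p g
  let Λ : ∀ y, K →ₗ[ℝ] ℝ := fun y => ∑ i, α y (S i y) • b.coord i
  have hev := (eventually_contMDiffAt_p_apply Φ).and
    ((eventually_contMDiffAt_transition Φ).and (eventually_transition_mem Φ))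
  obtain ⟨ρ, hρ⟩ := SmoothBumpFunction.exists_tsupport_subset (E := E) hev
  -- A vector `dR_g a` is read through `p`, the inverse transition recovers the coordinates of `a`,
  -- and `Λ` evaluates `α` on them in the frame `S`. The formula makes sense on all tangent vectors,
  -- which gives the extension off `T^αG`; `ρ` is supported where the transition is smooth and
  -- invertible.
  let ξ : ∀ g : G, Module.Dual ℝ (TangentSpace 𝓘(ℝ, E) g) := fun g =>
    ρ g • (Λ (𝒢.tgt g) ∘ₗ ((transition Φ g).inverse : K →ₗ[ℝ] K) ∘ₗ (D g : E →ₗ[ℝ] K))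
  refine ⟨ξ, fun V hV => ?_, ?_⟩
  · refine ρ.contMDiff_mul (h := fun g => Λ (𝒢.tgt g) ((transition Φ g).inverse (D g (V g))))
      fun g hg => ?_
    obtain ⟨h1, h2, T, hT⟩ := hρ hg
    have h3 : ContMDiffAt 𝓘(ℝ, E) 𝓘(ℝ, K) ∞ (fun g => D g (V g)) g :=
      h1 V (contMDiffAt_of_isSection hV g)
    have h4 : ContMDiffAt 𝓘(ℝ, E) 𝓘(ℝ, K →L[ℝ] K) ∞ (fun g => (transition Φ g).inverse) g := by
      have h5 : ContDiffAt ℝ ∞ ContinuousLinearMap.inverse (transition Φ g) := by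
        rw [← hT]; exact contDiffAt_map_inverse T
      exact h5.contMDiffAt.comp g h2
    have h5 := h4.clm_apply h3
    have h6 : (fun g => Λ (𝒢.tgt g) ((transition Φ g).inverse (D g (V g)))) = fun g =>
        ∑ i, α (𝒢.tgt g) (S i (𝒢.tgt g)) * b.coord i ((transition Φ g).inverse (D g (V g))) := by
      funext g
      simp [Λ]
    rw [h6]
    refine contMDiffAt_finsetSum fun i _ => ContMDiffAt.mul ?_ ?_
    · exact (hα (S i) (hS i)).contMDiffAt.comp g 𝒢.contMDiff_tgt.contMDiffAt
    · exact (LinearMap.toContinuousLinearMap (b.coord i)).contMDiff.contMDiffAt.comp g h5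
  · filter_upwards [ρ.eventuallyEq_one, eventually_transition_mem Φ,
      tendsto_tgt_unit.eventually (eventually_dRight_eq_mfderiv_p Φ),
      tendsto_tgt_unit.eventually Φ.deriv_k_p,
      tendsto_tgt_unit.eventually (Filter.eventually_all.2 hSk)] with g h1 ⟨T, hT⟩ h3 h4 h5 a
    set e : K := (mfderiv 𝓘(ℝ, E) 𝓘(ℝ, K) Φ.p (𝒢.unit (𝒢.tgt g)) a.1 : K)
    have h6 : D g (𝒢.dRight g a) = transition Φ g e := congrArg (D g) (h3 g rfl a)
    have h7 : (transition Φ g).inverse (D g (𝒢.dRight g a)) = e := by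
      rw [h6, ← hT, ContinuousLinearMap.inverse_equiv]
      exact T.symm_apply_apply e
    have h8 : ξ g (𝒢.dRight g a) = Λ (𝒢.tgt g) e := by
      change ρ g * Λ (𝒢.tgt g) ((transition Φ g).inverse (D g (𝒢.dRight g a))) = _
      rw [h7, h1, Pi.one_apply, one_mul]
    have h9 : a = ∑ i, b.coord i e • S i (𝒢.tgt g) := by
      apply Subtype.ext
      refine (h4 a.1 a.2).symm.trans ?_
      set L : K →L[ℝ] E := mfderiv 𝓘(ℝ, K) 𝓘(ℝ, E) (Φ.k (𝒢.tgt g)) (0 : K)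
      have h10 := congrArg L (b.sum_repr e)
      rw [map_sum] at h10
      simp only [map_smul] at h10
      refine h10.symm.trans ?_
      rw [Submodule.coe_sum]
      refine Finset.sum_congr rfl fun i _ => ?_
      exact congrArg (fun v : E => b.coord i e • v) (h5 i).symm
    rw [h8]
    conv_rhs => rw [h9]
    simp [Λ, mul_comm]

end LieGroupoid

/-! ### Naturality of contractions and wedge products -/

section Sharp

variable {V W : Type*} [AddCommGroup V] [Module ℝ V] [AddCommGroup W] [Module ℝ W]

theorem sharp_wedgeTwo (X Y : V) (α : Module.Dual ℝ V) :
    sharp (wedgeTwo X Y) α = α X • Y - α Y • X := by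
  simp [sharp, wedgeTwo, contractTwo]

theorem sharp_sum {ι : Type*} (s : Finset ι) (P : ι → ⋀[ℝ]^2 V) (α : Module.Dual ℝ V) :
    sharp (∑ i ∈ s, P i) α = ∑ i ∈ s, sharp (P i) α := by
  simp [sharp]

theorem map_wedgeTwo (f : V →ₗ[ℝ] W) (X Y : V) :
    exteriorPower.map 2 f (wedgeTwo X Y) = wedgeTwo (f X) (f Y) := by
  rw [wedgeTwo, exteriorPower.map_apply_ιMulti, wedgeTwo]
  congr 1
  funext i
  fin_cases i <;> rfl

theorem map_wedgeThree (f : V →ₗ[ℝ] W) (X Y Z : V) :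
    exteriorPower.map 3 f (wedgeThree X Y Z) = wedgeThree (f X) (f Y) (f Z) := by
  rw [wedgeThree, exteriorPower.map_apply_ιMulti, wedgeThree]
  congr 1
  funext i
  fin_cases i <;> rfl

/-- Both sides are linear in `P`, so it is enough to compare them on decomposable bivectors. -/
theorem sharp_map (f : V →ₗ[ℝ] W) (P : ⋀[ℝ]^2 V) (α : Module.Dual ℝ W) :
    sharp (exteriorPower.map 2 f P) α = f (sharp P (f.dualMap α)) := by
  have h : (exteriorPower.alternatingMapLinearEquiv (contractTwo W)) ∘ₗ exteriorPower.map 2 f =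
      exteriorPower.alternatingMapLinearEquiv
        ((LinearMap.llcomp ℝ (Module.Dual ℝ W) V W f ∘ₗ
          LinearMap.lcomp ℝ V f.dualMap).compAlternatingMap (contractTwo V)) := by
    apply exteriorPower.linearMap_ext
    ext v β
    simp [contractTwo]
  have h1 := congrArg (fun T => T P α) h
  refine h1.trans ?_
  rw [exteriorPower.alternatingMapLinearEquiv_comp]
  rfl

theorem wedgeThree_coe {S : Submodule ℝ V} (X Y Z : S) : wedgeThree X.1 Y.1 Z.1 =
    exteriorPower.map 3 S.subtype (wedgeThree X Y Z) :=
  (map_wedgeThree S.subtype X Y Z).symm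

end Sharp

/-! ### Comparing the two calculi at the units -/

namespace LieGroupoid

variable {E : Type u} {F : Type*} [NormedAddCommGroup E] [NormedSpace ℝ E]
  [NormedAddCommGroup F] [NormedSpace ℝ F]
  {G M : Type*} [TopologicalSpace G] [ChartedSpace E G] [TopologicalSpace M] [ChartedSpace F M]
  {𝒢 : LieGroupoid E F G M}

theorem rightBivector_unit (L : ∀ x, ⋀[ℝ]^2 (𝒢.algFiber x)) (x : M) :
    𝒢.rightBivector L (𝒢.unit x) = exteriorPower.map 2 (𝒢.algFiber x).subtype (L x) := by
  -- The fiber over `tgt (unit x)` is not definitionally the fiber over `x`; the target is replaced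
  -- by a variable `y` before substituting.
  have h1 : ∀ y, y = x → ∀ f : 𝒢.algFiber y →ₗ[ℝ] TangentSpace 𝓘(ℝ, E) (𝒢.unit x),
      (∀ a, (f a : E) = a.1) →
      exteriorPower.map 2 f (L y) = exteriorPower.map 2 (𝒢.algFiber x).subtype (L x) := by
    rintro y rfl f hf
    rw [show f = (𝒢.algFiber y).subtype from LinearMap.ext hf]
  exact h1 _ (𝒢.tgt_unit x) _ (𝒢.dRight_unit x)

theorem rightVectorField_unit (X : ∀ x, 𝒢.algFiber x) (x : M) :
    𝒢.rightVectorField X (𝒢.unit x) = (X x).1 := by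
  have h1 : ∀ y, y = x → ((X y).1 : E) = (X x).1 := by rintro y rfl; rfl
  exact (𝒢.dRight_unit x _).trans (h1 _ (𝒢.tgt_unit x))

theorem form_unit_apply {ξ : ∀ g : G, Module.Dual ℝ (TangentSpace 𝓘(ℝ, E) g)}
    {α : ∀ y, Module.Dual ℝ (𝒢.algFiber y)} {x : M}
    (h : ∀ a, ξ (𝒢.unit x) (𝒢.dRight (𝒢.unit x) a) = α (𝒢.tgt (𝒢.unit x)) a)
    (a : 𝒢.algFiber x) : ξ (𝒢.unit x) a.1 = α x a := by
  have h1 : ∀ y, y = x → ∃ a' : 𝒢.algFiber y, (a'.1 : E) = a.1 ∧ α y a' = α x a := by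
    rintro y rfl; exact ⟨a, rfl, rfl⟩
  obtain ⟨a', h2, h3⟩ := h1 _ (𝒢.tgt_unit x)
  rw [← h3, ← h a']
  exact congrArg (ξ (𝒢.unit x)) (h2.symm.trans (𝒢.dRight_unit x a').symm)

/-- An endomorphism of `TG` that restricts to `n` on `AG` and to the right-invariant endomorphism
defined by `n'` on `TᵅG` determines `n' = n`. -/
theorem endomorphism_eq {N : ∀ g : G, TangentSpace 𝓘(ℝ, E) g →ₗ[ℝ] TangentSpace 𝓘(ℝ, E) g}
    {n n' : ∀ x : M, 𝒢.algFiber x →ₗ[ℝ] 𝒢.algFiber x}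
    (hn : ∀ (x : M) (a : 𝒢.algFiber x), (n x a).1 = N (𝒢.unit x) a)
    (hn' : ∀ g a, N g (𝒢.dRight g a) = 𝒢.dRight g (n' (𝒢.tgt g) a)) : n' = n := by
  funext x
  ext a
  have h1 : ∀ y, y = x → ∃ a' : 𝒢.algFiber y, (a'.1 : E) = a.1 ∧
      ((n' y a').1 : E) = (n' x a).1 := by
    rintro y rfl; exact ⟨a, rfl, rfl⟩
  obtain ⟨a', h2, h3⟩ := h1 _ (𝒢.tgt_unit x)
  refine h3.symm.trans ?_
  refine (𝒢.dRight_unit x _).symm.trans ?_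
  refine (hn' _ _).symm.trans ?_
  refine Eq.trans ?_ (hn x a).symm
  exact congrArg (N (𝒢.unit x)) ((𝒢.dRight_unit x a').trans h2)

variable [IsManifold 𝓘(ℝ, E) ∞ G] [IsManifold 𝓘(ℝ, F) ∞ M]

theorem isSection_rightVectorField {X : ∀ x, 𝒢.algFiber x} (hX : 𝒢.algebroid.IsSection X) :
    (tangentAlgebroid E G).IsSection (𝒢.rightVectorField X) :=
  fun g => contMDiffAt_rightVectorField hX g

theorem isSection_sharp {L : ∀ x, ⋀[ℝ]^2 (𝒢.algFiber x)} (hL : 𝒢.algebroid.IsBivector L)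
    {α : ∀ y, Module.Dual ℝ (𝒢.algFiber y)} (hα : 𝒢.algebroid.IsForm α) :
    𝒢.algebroid.IsSection fun x => sharp (L x) (α x) := by
  intro x
  obtain ⟨p, X, Y, hX, hY, h⟩ := hL x
  have hsm : ∀ X Y, 𝒢.algebroid.IsSection X → 𝒢.algebroid.IsSection Y →
      ContMDiffAt 𝓘(ℝ, F) 𝓘(ℝ, E).tangent ∞ (fun y => (⟨𝒢.unit y, α y (X y) • (Y y).1⟩ :
        TangentBundle 𝓘(ℝ, E) G)) x := fun X Y hX hY =>
    contMDiffAt_tangent_smul (hα X hX).contMDiffAt (hY x)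
  have h1 := contMDiffAt_tangent_sum (Finset.univ : Finset (Fin p)) (x₀ := x)
    (𝒢.contMDiff_unit.contMDiffAt) fun i => contMDiffAt_tangent_add (hsm _ _ (hX i) (hY i))
      (contMDiffAt_tangent_smul (contMDiffAt_const (c := (-1 : ℝ))) (hsm _ _ (hY i) (hX i)))
  refine h1.congr_of_eventuallyEq ?_
  filter_upwards [h] with y hy
  refine tangentBundle_mk_congr rfl ?_
  rw [hy, sharp_sum, Submodule.coe_sum]
  refine Finset.sum_congr rfl fun i _ => ?_
  rw [sharp_wedgeTwo, neg_one_smul, ← sub_eq_add_neg]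
  rfl

/-- The chain rule applied to `f ∘ β`, the anchor being `Tβ`. Only the germ of `f'` at the unit
enters, so forms that are right-invariant merely near `1_x` are enough. -/
theorem act_unit {V : ∀ g : G, TangentSpace 𝓘(ℝ, E) g} {X : ∀ x, 𝒢.algFiber x} {x : M}
    {f' : G → ℝ} {f : M → ℝ} (hV : V (𝒢.unit x) = (X x).1) (hf : ContMDiff 𝓘(ℝ, F) 𝓘(ℝ, ℝ) ∞ f)
    (hff : f' =ᶠ[𝓝 (𝒢.unit x)] f ∘ 𝒢.tgt) :
    (tangentAlgebroid E G).act V f' (𝒢.unit x) = 𝒢.algebroid.act X f x := by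
  have h1 : HasMFDerivAt 𝓘(ℝ, F) 𝓘(ℝ, ℝ) f (𝒢.tgt (𝒢.unit x))
      (mfderiv 𝓘(ℝ, F) 𝓘(ℝ, ℝ) f x : F →L[ℝ] ℝ) := by
    rw [𝒢.tgt_unit]
    exact (hf.mdifferentiableAt (by simp)).hasMFDerivAt
  have h2 := (h1.comp (𝒢.unit x)
    (𝒢.contMDiff_tgt.mdifferentiableAt (by simp)).hasMFDerivAt).congr_of_eventuallyEq hff
  refine (congrArg (fun L : E →L[ℝ] ℝ => L (V (𝒢.unit x))) h2.mfderiv).trans ?_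
  rw [hV]
  rfl

variable [CompleteSpace E]

theorem mlieBracket_unit {V W : ∀ g : G, TangentSpace 𝓘(ℝ, E) g} {X Y : ∀ x, 𝒢.algFiber x} {x : M}
    (hX : 𝒢.algebroid.IsSection X) (hY : 𝒢.algebroid.IsSection Y)
    (hV : V =ᶠ[𝓝 (𝒢.unit x)] 𝒢.rightVectorField X)
    (hW : W =ᶠ[𝓝 (𝒢.unit x)] 𝒢.rightVectorField Y) :
    (tangentAlgebroid E G).bracket V W (𝒢.unit x) = (𝒢.algebroid.bracket X Y x).1 :=
  (hV.mlieBracket_vectorField_eq hW).trans (coe_bracket hX hY x).symm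

theorem lieDerivForm_unit {V W : ∀ g : G, TangentSpace 𝓘(ℝ, E) g} {X Z : ∀ x, 𝒢.algFiber x} {x : M}
    {ξ : ∀ g : G, Module.Dual ℝ (TangentSpace 𝓘(ℝ, E) g)}
    {α : ∀ y, Module.Dual ℝ (𝒢.algFiber y)} (hα : 𝒢.algebroid.IsForm α)
    (hξ : ∀ᶠ g in 𝓝 (𝒢.unit x), ∀ a, ξ g (𝒢.dRight g a) = α (𝒢.tgt g) a)
    (hX : 𝒢.algebroid.IsSection X) (hZ : 𝒢.algebroid.IsSection Z)
    (hV : V =ᶠ[𝓝 (𝒢.unit x)] 𝒢.rightVectorField X)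
    (hW : W =ᶠ[𝓝 (𝒢.unit x)] 𝒢.rightVectorField Z) :
    (tangentAlgebroid E G).lieDerivForm V ξ W (𝒢.unit x) = 𝒢.algebroid.lieDerivForm X α Z x := by
  unfold AlgebroidData.lieDerivForm
  rw [mlieBracket_unit hX hZ hV hW, form_unit_apply hξ.self_of_nhds]
  congr 1
  refine act_unit (hV.self_of_nhds.trans (rightVectorField_unit X x)) (hα Z hZ) ?_
  filter_upwards [hξ, hW] with g h1 h2
  rw [h2]
  exact h1 _

/-- The hypothesis `hS'` says that `S'` sees a covector only through its pullback by `dR_g`, so the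
values of the forms off `T^αG` are irrelevant. It is stated for a general `S'` to cover both `Π♯`
and `N ∘ Π♯`. -/
theorem formBracket_unit {S' : ∀ g : G, Module.Dual ℝ (TangentSpace 𝓘(ℝ, E) g) →ₗ[ℝ]
      TangentSpace 𝓘(ℝ, E) g}
    {S : ∀ x, Module.Dual ℝ (𝒢.algFiber x) →ₗ[ℝ] 𝒢.algFiber x} {x : M}
    {ξ η : ∀ g : G, Module.Dual ℝ (TangentSpace 𝓘(ℝ, E) g)}
    {α β : ∀ y, Module.Dual ℝ (𝒢.algFiber y)} {W : ∀ g : G, TangentSpace 𝓘(ℝ, E) g}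
    {Z : ∀ x, 𝒢.algFiber x}
    (hα : 𝒢.algebroid.IsForm α) (hβ : 𝒢.algebroid.IsForm β)
    (hξ : ∀ᶠ g in 𝓝 (𝒢.unit x), ∀ a, ξ g (𝒢.dRight g a) = α (𝒢.tgt g) a)
    (hη : ∀ᶠ g in 𝓝 (𝒢.unit x), ∀ a, η g (𝒢.dRight g a) = β (𝒢.tgt g) a)
    (hSα : 𝒢.algebroid.IsSection fun x => S x (α x))
    (hSβ : 𝒢.algebroid.IsSection fun x => S x (β x)) (hZ : 𝒢.algebroid.IsSection Z)
    (hS' : ∀ g (θ : Module.Dual ℝ (TangentSpace 𝓘(ℝ, E) g)) (δ : Module.Dual ℝ (𝒢.algFiber (𝒢.tgt g))),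
      (∀ a, θ (𝒢.dRight g a) = δ a) → S' g θ = 𝒢.dRight g (S (𝒢.tgt g) δ))
    (hW : W = 𝒢.rightVectorField Z) :
    (tangentAlgebroid E G).formBracket S' ξ η W (𝒢.unit x) =
      𝒢.algebroid.formBracket S α β Z x := by
  have h1 : (fun g => S' g (ξ g)) =ᶠ[𝓝 (𝒢.unit x)] 𝒢.rightVectorField fun x => S x (α x) := by
    filter_upwards [hξ] with g h using hS' g _ _ h
  have h2 : (fun g => S' g (η g)) =ᶠ[𝓝 (𝒢.unit x)] 𝒢.rightVectorField fun x => S x (β x) := by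
    filter_upwards [hη] with g h using hS' g _ _ h
  have hW' : W =ᶠ[𝓝 (𝒢.unit x)] 𝒢.rightVectorField Z := .of_eq hW
  unfold AlgebroidData.formBracket
  rw [lieDerivForm_unit hβ hη hSα hZ h1 hW', lieDerivForm_unit hα hξ hSβ hZ h2 hW',
    act_unit (f := fun c => β c (S c (α c))) (X := Z) (by rw [hW, rightVectorField_unit])
      (hβ _ hSα) ?_]
  filter_upwards [hη, h1] with g h3 h4
  rw [h4]
  exact h3 _

end LieGroupoid

/-! ### The proposition -/

theorem proposition3p3
    {E F : Type*} [NormedAddCommGroup E] [NormedSpace ℝ E] [FiniteDimensional ℝ E]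
    [NormedAddCommGroup F] [NormedSpace ℝ F] [FiniteDimensional ℝ F]
    {G M : Type*}
    [TopologicalSpace G] [T2Space G] [SigmaCompactSpace G] [ChartedSpace E G]
    [IsManifold 𝓘(ℝ, E) ∞ G]
    [TopologicalSpace M] [T2Space M] [SigmaCompactSpace M] [ChartedSpace F M]
    [IsManifold 𝓘(ℝ, F) ∞ M]
    (𝒢 : LieGroupoid E F G M)
    (P : ∀ g : G, ⋀[ℝ]^2 (TangentSpace 𝓘(ℝ, E) g))
    (N : ∀ g : G, TangentSpace 𝓘(ℝ, E) g →ₗ[ℝ] TangentSpace 𝓘(ℝ, E) g)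
    (hPN : 𝒢.IsRightInvariantPN P N)
    (L : ∀ x : M, ⋀[ℝ]^2 (𝒢.algFiber x)) (hL : 𝒢.algebroid.IsBivector L)
    (hLP : ∀ g, P g = 𝒢.rightBivector L g)
    (n : ∀ x : M, 𝒢.algFiber x →ₗ[ℝ] 𝒢.algFiber x)
    (hnN : ∀ (x : M) (a : 𝒢.algFiber x),
      ((n x a : 𝒢.algFiber x) : TangentSpace 𝓘(ℝ, E) (𝒢.unit x)) = N (𝒢.unit x) a) :
    𝒢.algebroid.IsSchoutenBracket L L 0 ∧
    (∀ X Y, 𝒢.algebroid.IsSection X → 𝒢.algebroid.IsSection Y →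
      ∀ x, 𝒢.algebroid.torsion n X Y x = 0) ∧
    (∀ x, n x ∘ₗ sharp (L x) = sharp (L x) ∘ₗ (n x).dualMap) ∧
    (∀ α β Z, 𝒢.algebroid.IsForm α → 𝒢.algebroid.IsForm β → 𝒢.algebroid.IsSection Z →
      ∀ x, 𝒢.algebroid.concomitant L n α β Z x = 0) := by
  have : CompleteSpace E := FiniteDimensional.complete ℝ E
  obtain ⟨hPNG, -, n', hn', hNn'⟩ := hPN
  obtain rfl := LieGroupoid.endomorphism_eq hnN hNn'
  have hcomm : ∀ x, n' x ∘ₗ sharp (L x) = sharp (L x) ∘ₗ (n' x).dualMap := by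
    intro x
    ext θ
    -- Commutation is pointwise: a covector on `A_x G` is extended linearly to `T_{1_x} G`, and any
    -- extension works because `Π` at `1_x` comes from `⋀² A_x G`.
    obtain ⟨θ', hθ'⟩ := LinearMap.exists_extend θ
    have h1 := LinearMap.congr_fun (hPNG.comm (𝒢.unit x)) θ'
    simp only [LinearMap.comp_apply, hLP, LieGroupoid.rightBivector_unit, sharp_map] at h1
    have h2 : (𝒢.algFiber x).subtype.dualMap θ' = θ := hθ'
    have h3 : (𝒢.algFiber x).subtype.dualMap ((N (𝒢.unit x)).dualMap θ') = (n' x).dualMap θ := by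
      ext a
      rw [← h2]
      exact congrArg θ' (hnN x a).symm
    rw [h2, h3] at h1
    exact (hnN x _).trans h1
  refine ⟨?_, ?_, hcomm, ?_⟩
  · intro x p q X Y Z W hX hY hZ hW hXY hZW
    -- A local decomposition of `Λ` near `x` right-translates to one of `Π` near `1_x`, to which the
    -- vanishing on `G` applies.
    have hloc : ∀ (r : ℕ) (X Y : Fin r → ∀ x, 𝒢.algFiber x),
        (∀ᶠ y in 𝓝 x, L y = ∑ i, wedgeTwo (X i y) (Y i y)) → ∀ᶠ g in 𝓝 (𝒢.unit x),
        P g = ∑ i, wedgeTwo (𝒢.rightVectorField (X i) g) (𝒢.rightVectorField (Y i) g) := by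
      intro r X Y h
      filter_upwards [LieGroupoid.tendsto_tgt_unit.eventually h] with g hg
      rw [hLP, LieGroupoid.rightBivector, hg, map_sum]
      exact Finset.sum_congr rfl fun i _ => map_wedgeTwo _ _ _
    have h1 := hPNG.poisson (𝒢.unit x) p q (fun i => 𝒢.rightVectorField (X i))
      (fun i => 𝒢.rightVectorField (Y i)) (fun i => 𝒢.rightVectorField (Z i))
      (fun i => 𝒢.rightVectorField (W i))
      (fun i => LieGroupoid.isSection_rightVectorField (hX i))
      (fun i => LieGroupoid.isSection_rightVectorField (hY i))
      (fun i => LieGroupoid.isSection_rightVectorField (hZ i))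
      (fun i => LieGroupoid.isSection_rightVectorField (hW i)) (hloc p X Y hXY) (hloc q Z W hZW)
    have hb : ∀ X Y, 𝒢.algebroid.IsSection X → 𝒢.algebroid.IsSection Y →
        (tangentAlgebroid E G).bracket (𝒢.rightVectorField X) (𝒢.rightVectorField Y) (𝒢.unit x) =
          (𝒢.algebroid.bracket X Y x).1 := fun X Y hX hY =>
      LieGroupoid.mlieBracket_unit hX hY .rfl .rfl
    simp only [hb _ _ (hX _) (hZ _), hb _ _ (hX _) (hW _), hb _ _ (hY _) (hZ _),
      hb _ _ (hY _) (hW _), LieGroupoid.rightVectorField_unit] at h1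
    simp only [wedgeThree_coe, ← map_sub, ← map_add, ← map_sum] at h1
    -- The vanishing holds in `⋀³ T_{1_x} G`; over a field `⋀³` of the inclusion of `A_x G` is
    -- injective.
    refine exteriorPower.map_injective_field (f := (𝒢.algFiber x).subtype)
      (𝒢.algFiber x).injective_subtype ?_
    rw [← h1, Pi.zero_apply, map_zero, Pi.zero_apply]
  · intro X Y hX hY x
    have h1 := hPNG.nijenhuis _ _ (LieGroupoid.isSection_rightVectorField hX)
      (LieGroupoid.isSection_rightVectorField hY) (𝒢.unit x)
    have hr : ∀ X, (fun g => N g (𝒢.rightVectorField X g)) =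
        𝒢.rightVectorField fun y => n' y (X y) := fun X => funext fun g => hNn' g _
    have hb : ∀ X Y, 𝒢.algebroid.IsSection X → 𝒢.algebroid.IsSection Y →
        (tangentAlgebroid E G).bracket (𝒢.rightVectorField X) (𝒢.rightVectorField Y) (𝒢.unit x) =
          (𝒢.algebroid.bracket X Y x).1 := fun X Y hX hY =>
      LieGroupoid.mlieBracket_unit hX hY .rfl .rfl
    unfold AlgebroidData.torsion at h1
    rw [hr, hr, hb _ _ (hn' _ hX) (hn' _ hY), hb _ _ (hn' _ hX) hY, hb _ _ hX (hn' _ hY),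
      hb _ _ hX hY, ← hnN, ← hnN, ← hnN, ← hnN] at h1
    exact Subtype.ext h1
  · intro α β Z hα hβ hZ x
    obtain ⟨ξ, hξ, hξα⟩ := LieGroupoid.exists_isForm_eq_dRight hα x
    obtain ⟨η, hη, hηβ⟩ := LieGroupoid.exists_isForm_eq_dRight hβ x
    have h1 := hPNG.concomitant_eq_zero ξ η _ hξ hη
      (LieGroupoid.isSection_rightVectorField hZ) (𝒢.unit x)
    have hdual : ∀ {α}, 𝒢.algebroid.IsForm α →
        𝒢.algebroid.IsForm fun y => (n' y).dualMap (α y) := fun hα X hX => hα _ (hn' X hX)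
    have hrel : ∀ {ξ : ∀ g : G, Module.Dual ℝ (TangentSpace 𝓘(ℝ, E) g)}
        {α : ∀ y, Module.Dual ℝ (𝒢.algFiber y)},
        (∀ᶠ g in 𝓝 (𝒢.unit x), ∀ a, ξ g (𝒢.dRight g a) = α (𝒢.tgt g) a) →
        ∀ᶠ g in 𝓝 (𝒢.unit x), ∀ a, (N g).dualMap (ξ g) (𝒢.dRight g a) =
          (n' (𝒢.tgt g)).dualMap (α (𝒢.tgt g)) a := by
      intro ξ α h
      filter_upwards [h] with g hg a
      exact (congrArg (ξ g) (hNn' g a)).trans (hg _)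
    have hP : ∀ g (θ : Module.Dual ℝ (TangentSpace 𝓘(ℝ, E) g))
        (δ : Module.Dual ℝ (𝒢.algFiber (𝒢.tgt g))), (∀ a, θ (𝒢.dRight g a) = δ a) →
        sharp (P g) θ = 𝒢.dRight g (sharp (L (𝒢.tgt g)) δ) := by
      intro g θ δ h
      have h2 : (𝒢.dRight g).dualMap θ = δ := LinearMap.ext h
      rw [hLP, LieGroupoid.rightBivector, sharp_map, h2]
    have hNP : ∀ g (θ : Module.Dual ℝ (TangentSpace 𝓘(ℝ, E) g))
        (δ : Module.Dual ℝ (𝒢.algFiber (𝒢.tgt g))), (∀ a, θ (𝒢.dRight g a) = δ a) →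
        (N g ∘ₗ sharp (P g)) θ = 𝒢.dRight g ((n' (𝒢.tgt g) ∘ₗ sharp (L (𝒢.tgt g))) δ) := by
      intro g θ δ h
      rw [LinearMap.comp_apply, hP g θ δ h, hNn', LinearMap.comp_apply]
    have hsec : ∀ {α}, 𝒢.algebroid.IsForm α →
        𝒢.algebroid.IsSection fun y => sharp (L y) (α y) := fun h =>
      LieGroupoid.isSection_sharp hL h
    unfold AlgebroidData.concomitant at h1
    -- The four brackets of the concomitant are matched in order. In the last one `n*` acts by
    -- inserting `nZ`, whose right-invariant field is `N` applied to that of `Z`.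
    rw [LieGroupoid.formBracket_unit (S := fun y => n' y ∘ₗ sharp (L y)) hα hβ hξα hηβ
        (hn' _ (hsec hα)) (hn' _ (hsec hβ)) hZ hNP rfl,
      LieGroupoid.formBracket_unit (hdual hα) hβ (hrel hξα) hηβ
        (hsec (hdual hα)) (hsec hβ) hZ hP rfl,
      LieGroupoid.formBracket_unit hα (hdual hβ) hξα (hrel hηβ)
        (hsec hα) (hsec (hdual hβ)) hZ hP rfl,
      LieGroupoid.formBracket_unit hα hβ hξα hηβ (hsec hα) (hsec hβ) (hn' _ hZ) hP
        (W := fun c => N c (𝒢.rightVectorField Z c)) (funext fun g => hNn' g _)] at h1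
    exact h1
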